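/- Let $\beta$ be a diagram of a virtual braid on $k\ge 1$ strands (a word in the classical generators $\sigma_i^{\pm1}$ and the virtual generators $\tau_i$, drawn from top to bottom). An Alexander numbering of $\beta$ assigns an integer to every arc so that at each classical crossing, with both strands running downwards, the number on the right is one more than the number on the left, both above and below the crossing, so that numbers do not change along a strand at virtual crossings, and so that the numbers $\lambda_1,\dots,\lambda_k$ at the top of $\beta$ coincide with those at the bottom. Assume that $\beta$ admits such a numbering with top numbers $\lambda_1,\dots,\lambda_k$, let $q=p^r$ with $p$ prime and $r\ge 1$, and assume that the closure $K=\widehat{\beta^q}$ is a virtual knot diagram (i.e. has one component); it is then an almost classical diagram. Virtual knot diagrams are regarded here as Gauss diagrams. For a virtual knot diagram $D$, let $\Delta_D(t)\in\mathbb Z[t^{\pm1}]$ be its Alexander polynomial: a generator of the smallest principal ideal containing the first elementary ideal $\mathcal E_1$ of the Jacobian matrix obtained by Fox calculus from the Wirtinger presentation of the knot group of $D$ (one generator for each arc from one classical under-crossing to the next, one relator $x_k^{-\varepsilon}x_ix_k^{\varepsilon}x_{i+1}^{-1}$ for each classical crossing of sign $\varepsilon$ with over-arc $x_k$, incoming under-arc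 $x_i$ and outgoing under-arc $x_{i+1}$; virtual crossings are ignored), all generators being sent to $t$. It is defined up to multiplication by $\pm t^m$. Then $K$ is $q$-periodic, i.e. invariant under a rotation of order $q$; its quotient $K_*$ by this rotation is the knot diagram $\widehat\beta$; and 1. $\Delta_{K_*}(t)$ divides $\Delta_K(t)$ in $\mathbb Z[t^{\pm1}]$; 2. $\Delta_K(t)\doteq \bigl(\Delta_{K_*}(t)\bigr)^{q}\,f(t)^{\,q-1} \pmod p$, where $f(t)=\sum_{i=1}^k t^{\lambda_i}$, where $\doteq \pmod p$ means that, after reduction of the coefficients modulo $p$, the two sides are equal up to a factor $\pm t^m$, $m\in\mathbb Z$. -/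

import Mathlib

noncomputable section

/-! ### Gauss diagrams of virtual knots -/

/-- The Gauss diagram of an oriented virtual knot diagram.  The base circle carries two points
for every classical crossing `c`, namely the passages `(c, true)` (the knot runs over `c`) and
`(c, false)` (the knot runs under `c`).  The permutation `next` sends a passage to the one which
follows it along the knot; since there is only one base circle, it has only one cycle.
Virtual crossings leave no trace.  A diagram without classical crossings is the bare circle. -/
structure GaussDiagram where
  Crossing : Type
  finite : Finite Crossing
  /-- the crossing is right-handed, i.e. its sign is `+1` -/
  positive : Crossing → Bool
  next : Equiv.Perm (Crossing × Bool)
  connected : ∀ e f, next.SameCycle e f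

namespace GaussDiagram

/-- An isomorphism of Gauss diagrams: a bijection of the crossings which respects the signs, the
cyclic order, and the distinction between over- and under-passages. -/
structure Iso (D D' : GaussDiagram) where
  toEquiv : D.Crossing ≃ D'.Crossing
  positive_apply : ∀ c, D'.positive (toEquiv c) = D.positive c
  next_apply : ∀ e : D.Crossing × Bool,
    D'.next (toEquiv e.1, e.2) = (toEquiv (D.next e).1, (D.next e).2)

/-! ### The Wirtinger presentation, Fox calculus and the Alexander polynomial -/

/-- A short arc runs from one passage to the next; it is named after the passage at which it
starts.  The long arcs (the generators of the Wirtinger presentation) run from one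
under-passage to the next, so they arise by gluing the short arc which ends at an over-passage
to the short arc which starts there. -/
def LongArc (D : GaussDiagram) : Type :=
  Quot fun e f : D.Crossing × Bool => f = D.next e ∧ f.2 = true

/-- The long arc which contains the short arc starting at the passage `e`. -/
def longArc (D : GaussDiagram) (e : D.Crossing × Bool) : D.LongArc := Quot.mk _ e

/-- The Wirtinger relator `x_k ^ (-ε) * x_i * x_k ^ ε * x_{i+1} ^ (-1)` of a crossing of sign `ε`
with incoming under-arc `x_i`, outgoing under-arc `x_{i+1}` and over-arc `x_k`, as a word in the
format of `FreeGroup`: `(x, true)` stands for `x` and `(x, false)` for its inverse. -/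
def relator (D : GaussDiagram) (c : D.Crossing) : List (D.LongArc × Bool) :=
  [(D.longArc (c, true), !D.positive c),
   (D.longArc (D.next.symm (c, false)), true),
   (D.longArc (c, true), D.positive c),
   (D.longArc (c, false), false)]

end GaussDiagram

open Classical in
/-- The Fox derivative `∂w/∂x` of a word `w`, followed by the abelianization map which sends every
generator to `t`: it is determined by `∂x/∂x = 1`, `∂x⁻¹/∂x = -x⁻¹`, `∂y/∂x = 0` for `y ≠ x`, and
`∂(uv)/∂x = ∂u/∂x + u ∂v/∂x`. -/
def foxDerivative {X : Type} (x : X) : List (X × Bool) → LaurentPolynomial ℤ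
  | [] => 0
  | (y, true) :: w =>
      (if y = x then 1 else 0) + LaurentPolynomial.T 1 * foxDerivative x w
  | (y, false) :: w =>
      (if y = x then -LaurentPolynomial.T (-1) else 0)
        + LaurentPolynomial.T (-1) * foxDerivative x w

/-- The `l`-th elementary ideal of a matrix with `n` columns: it is generated by the minors of size
`n - l` (by the empty minor `1` if `n ≤ l`).  Repeated rows or columns only add zeros. -/
def elementaryIdeal {R m n : Type} [CommRing R] (l : ℕ) (A : Matrix m n R) : Ideal R :=
  Ideal.span {d | ∃ (f : Fin (Nat.card n - l) → m) (g : Fin (Nat.card n - l) → n),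
    d = (A.submatrix f g).det}

namespace GaussDiagram

/-- The Jacobian matrix of the Wirtinger presentation. -/
def jacobian (D : GaussDiagram) : Matrix D.Crossing D.LongArc (LaurentPolynomial ℤ) :=
  fun c a => foxDerivative a (D.relator c)

/-- `Δ` is an Alexander polynomial of `D`: a generator of the smallest principal ideal which
contains the first elementary ideal. It is unique up to multiplication by units `± t ^ m`.
(The bare circle has no crossings; its first elementary ideal is the whole ring and `Δ = 1`.) -/
def IsAlexanderPolynomial (D : GaussDiagram) (Δ : LaurentPolynomial ℤ) : Prop :=
  elementaryIdeal 1 D.jacobian ≤ Ideal.span {Δ} ∧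
    ∀ d, elementaryIdeal 1 D.jacobian ≤ Ideal.span {d} → Ideal.span {Δ} ≤ Ideal.span {d}

/-- Every Gauss diagram has an Alexander polynomial. -/
theorem exists_isAlexanderPolynomial (D : GaussDiagram) : ∃ Δ, D.IsAlexanderPolynomial Δ := by
  classical
  have := D.finite
  have : Finite D.LongArc := inferInstanceAs (Finite (Quot _))
  have : UniqueFactorizationMonoid (LaurentPolynomial ℤ) :=
    UniqueFactorizationMonoid.of_isLocalization
      (Submonoid.powers (Polynomial.X : Polynomial ℤ)) (LaurentPolynomial ℤ)
  let _ : GCDMonoid (LaurentPolynomial ℤ) := UniqueFactorizationMonoid.toGCDMonoid _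
  have key : ∀ S : Finset (LaurentPolynomial ℤ), ∃ g, ∀ d, (∀ x ∈ S, d ∣ x) ↔ d ∣ g := by
    intro S
    induction S using Finset.induction_on with
    | empty => exact ⟨0, by simp⟩
    | insert a S _ ih =>
      obtain ⟨g, hg⟩ := ih
      refine ⟨gcd a g, fun d => ?_⟩
      rw [Finset.forall_mem_insert, hg, dvd_gcd_iff]
  let r := Nat.card D.LongArc - 1
  let φ : (Fin r → D.Crossing) × (Fin r → D.LongArc) → LaurentPolynomial ℤ :=
    fun p => (D.jacobian.submatrix p.1 p.2).det
  obtain ⟨g, hg⟩ := key (Set.finite_range φ).toFinset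
  have h : ∀ d, elementaryIdeal 1 D.jacobian ≤ Ideal.span {d} ↔ d ∣ g := by
    intro d
    rw [← hg d, elementaryIdeal, Ideal.span_le]
    constructor
    · intro H x hx
      obtain ⟨p, rfl⟩ := (Set.finite_range φ).mem_toFinset.1 hx
      exact Ideal.mem_span_singleton.1 (H ⟨p.1, p.2, rfl⟩)
    · rintro H _ ⟨f, f', rfl⟩
      exact Ideal.mem_span_singleton.2
        (H _ ((Set.finite_range φ).mem_toFinset.2 ⟨(f, f'), rfl⟩))
  exact ⟨g, (h g).2 dvd_rfl, fun d hd => Ideal.span_singleton_le_span_singleton.2 ((h d).1 hd)⟩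

/-! ### Periodic diagrams and their quotients -/

/-- `ρ` generates a free action of `ℤ/q` on the Gauss diagram `D` by automorphisms. As `D` has only
one base circle, every automorphism turns this circle, so `ρ` is a rotation by `2πj/q` with `j`
prime to `q`, and it generates the same group as the rotation by `2π/q`. -/
structure IsRotation (D : GaussDiagram) (q : ℕ) (ρ : Equiv.Perm D.Crossing) : Prop where
  positive_apply : ∀ c, D.positive (ρ c) = D.positive c
  next_apply : ∀ e : D.Crossing × Bool, D.next (ρ e.1, e.2) = (ρ (D.next e).1, (D.next e).2)
  pow_eq_one : ρ ^ q = 1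
  free : ∀ j, 0 < j → j < q → ∀ c, (ρ ^ j) c ≠ c

/-- A diagram is `q`-periodic if it is invariant under a rotation of order `q`. -/
def IsPeriodic (D : GaussDiagram) (q : ℕ) : Prop := ∃ ρ, D.IsRotation q ρ

theorem next_zpow {D : GaussDiagram} {q : ℕ} {ρ : Equiv.Perm D.Crossing} (h : D.IsRotation q ρ)
    (m : ℤ) (e : D.Crossing × Bool) :
    D.next ((ρ ^ m) e.1, e.2) = ((ρ ^ m) (D.next e).1, (D.next e).2) := by
  induction m generalizing e with
  | zero => simp
  | succ n ih =>
    rw [zpow_add, zpow_one]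
    have := ih (ρ e.1, e.2)
    rw [h.next_apply] at this
    exact this
  | pred n ih =>
    rw [sub_eq_add_neg, zpow_add, zpow_neg_one]
    have h1 : D.next (ρ⁻¹ e.1, e.2) = (ρ⁻¹ (D.next e).1, (D.next e).2) := by
      have := h.next_apply (ρ⁻¹ e.1, e.2)
      have hr : ρ (ρ⁻¹ e.1) = e.1 := ρ.apply_symm_apply e.1
      rw [hr] at this
      have h2 : D.next e = (ρ (D.next (ρ⁻¹ e.1, e.2)).1, (D.next (ρ⁻¹ e.1, e.2)).2) := this
      rw [h2]
      exact Prod.ext (ρ.symm_apply_apply _).symm rfl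
    have := ih (ρ⁻¹ e.1, e.2)
    rw [h1] at this
    exact this

theorem positive_zpow {D : GaussDiagram} {q : ℕ} {ρ : Equiv.Perm D.Crossing}
    (h : D.IsRotation q ρ) (m : ℤ) (c : D.Crossing) : D.positive ((ρ ^ m) c) = D.positive c := by
  induction m generalizing c with
  | zero => simp
  | succ n ih =>
    rw [zpow_add, zpow_one, Equiv.Perm.mul_apply, ih, h.positive_apply]
  | pred n ih =>
    rw [sub_eq_add_neg, zpow_add, zpow_neg_one, Equiv.Perm.mul_apply, ih, ← h.positive_apply]
    simp

/-- The map of passages induced on the orbits of `ρ` by a map of passages that commutes with it. -/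
def orbitMap {C : Type} (ρ : Equiv.Perm C) (f : C × Bool → C × Bool)
    (hf : ∀ (m : ℤ) (e : C × Bool), f ((ρ ^ m) e.1, e.2) = ((ρ ^ m) (f e).1, (f e).2))
    (e : Quotient (Equiv.Perm.SameCycle.setoid ρ) × Bool) :
    Quotient (Equiv.Perm.SameCycle.setoid ρ) × Bool :=
  Quotient.liftOn e.1 (fun c => (Quotient.mk _ (f (c, e.2)).1, (f (c, e.2)).2)) (by
    rintro c d ⟨m, rfl⟩
    have := hf m (c, e.2)
    simp only at this
    rw [this]
    exact Prod.ext (Quotient.sound ⟨m, rfl⟩) rfl)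

theorem next_symm_zpow {D : GaussDiagram} {q : ℕ} {ρ : Equiv.Perm D.Crossing}
    (h : D.IsRotation q ρ) (m : ℤ) (e : D.Crossing × Bool) :
    D.next.symm ((ρ ^ m) e.1, e.2) = ((ρ ^ m) (D.next.symm e).1, (D.next.symm e).2) := by
  rw [Equiv.symm_apply_eq, next_zpow h]
  simp

/-- The quotient of a periodic diagram by its rotation: the crossings are the orbits of crossings,
and the signs and the cyclic order are inherited. -/
def quotient (D : GaussDiagram) {q : ℕ} {ρ : Equiv.Perm D.Crossing} (h : D.IsRotation q ρ) :
    GaussDiagram where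
  Crossing := Quotient (Equiv.Perm.SameCycle.setoid ρ)
  finite := haveI := D.finite; inferInstance
  positive := Quotient.lift D.positive (by
    rintro c d ⟨m, rfl⟩
    exact (positive_zpow h m c).symm)
  next :=
    { toFun := orbitMap ρ D.next (next_zpow h)
      invFun := orbitMap ρ D.next.symm (next_symm_zpow h)
      left_inv := by
        rintro ⟨c, b⟩
        induction c using Quotient.inductionOn
        simp [orbitMap]
      right_inv := by
        rintro ⟨c, b⟩
        induction c using Quotient.inductionOn
        simp [orbitMap] }
  connected := by
    have := D.finite
    rintro ⟨c, b⟩ ⟨d, b'⟩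
    induction c using Quotient.inductionOn with
    | h c =>
    induction d using Quotient.inductionOn with
    | h d =>
    obtain ⟨n, hn⟩ := (D.connected (c, b) (d, b')).exists_nat_pow_eq
    refine ⟨n, ?_⟩
    rw [zpow_natCast]
    suffices H : ∀ (n : ℕ) (e : D.Crossing × Bool),
        ((⟨orbitMap ρ D.next (next_zpow h), orbitMap ρ D.next.symm (next_symm_zpow h), _, _⟩ :
          Equiv.Perm (Quotient (Equiv.Perm.SameCycle.setoid ρ) × Bool)) ^ n)
          (Quotient.mk _ e.1, e.2)
        = (Quotient.mk _ ((D.next ^ n) e).1, ((D.next ^ n) e).2) by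
      rw [H n (c, b), hn]
    intro n
    induction n with
    | zero => intro e; rfl
    | succ n ih =>
      intro e
      rw [pow_succ, pow_succ, Equiv.Perm.mul_apply, Equiv.Perm.mul_apply, ← ih]
      rfl

end GaussDiagram

/-! ### Virtual braids and their closures -/

/-- The three kinds of crossings which occur in a virtual braid. -/
inductive CrossingKind
  | positive
  | negative
  | virtual

/-- A letter of a braid word on `k` strands: a crossing between the strands at the neighbouring
positions `pos` and `pos + 1` (positions are counted from `0`, from left to right).
The classical kinds are `σ_i` and its inverse, the virtual one is `τ_i`. -/
structure BraidLetter (k : ℕ) where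
  pos : ℕ
  lt : pos + 1 < k
  kind : CrossingKind

namespace BraidLetter

variable {k : ℕ}

def left (x : BraidLetter k) : Fin k := ⟨x.pos, Nat.lt_of_succ_lt x.lt⟩

def right (x : BraidLetter k) : Fin k := ⟨x.pos + 1, x.lt⟩

theorem left_ne_right (x : BraidLetter k) : x.left ≠ x.right := by
  simp [left, right]

/-- The strand which enters the letter at position `i` leaves it at position `x.perm i`. -/
def perm (x : BraidLetter k) : Equiv.Perm (Fin k) := Equiv.swap x.left x.right

def IsClassical (x : BraidLetter k) : Prop := x.kind ≠ CrossingKind.virtual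

def isPositive (x : BraidLetter k) : Bool :=
  match x.kind with
  | CrossingKind.positive => true
  | _ => false

/-- The position at which the over-strand (`b = true`) or the under-strand (`b = false`) enters a
classical crossing. All strands run downwards, so that at a positive crossing the over-strand runs
from the top right to the bottom left, and at a negative one from the top left to the bottom
right. -/
def entry (x : BraidLetter k) (b : Bool) : Fin k := if x.isPositive = b then x.right else x.left

theorem entry_injective (x : BraidLetter k) : Function.Injective x.entry := by
  have h1 := x.left_ne_right
  have h2 := h1.symm
  intro b b' h
  unfold entry at h
  generalize x.isPositive = s at h
  cases s <;> cases b <;> cases b' <;> simp_all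

end BraidLetter

/-- A (diagram of a) virtual braid on `k` strands: a word in the crossings, read from top to
bottom. -/
abbrev VirtualBraid (k : ℕ) : Type := List (BraidLetter k)

namespace VirtualBraid

variable {k : ℕ}

/-- The power `β ^ q`: `q` copies of `β` stacked on top of each other. -/
def power (β : VirtualBraid k) (q : ℕ) : VirtualBraid k := (List.replicate q β).flatten

/-- The strand which starts at position `i` at the top ends at position `perm β i` at the bottom. -/
def perm : VirtualBraid k → Equiv.Perm (Fin k)
  | [] => 1
  | x :: β => perm β * x.perm

/-- The closure of the braid has exactly one component: there is at least one strand, and the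
permutation of the strands has only one cycle. -/
def ClosureIsKnot (β : VirtualBraid k) : Prop := 0 < k ∧ ∀ i j, (perm β).SameCycle i j

/-- Alexander numberings of a braid. `β.HasNumbering a b` says that the arcs of `β` can be numbered
so that the arcs at the top carry the numbers `a`, those at the bottom carry the numbers `b`, and
the numbering rules hold at all crossings: at a classical crossing the number on the right exceeds
the number on the left by one, both above and below the crossing (so each position keeps its
number); at a virtual crossing each strand keeps its number. -/
def HasNumbering : VirtualBraid k → (Fin k → ℤ) → (Fin k → ℤ) → Prop
  | [], a, b => a = b
  | x :: β, a, b =>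
    match x.kind with
    | CrossingKind.virtual => HasNumbering β (a ∘ x.perm) b
    | _ => a x.right = a x.left + 1 ∧ HasNumbering β a b

/-- `a` lists the numbers, at the top strands, of an Alexander numbering of the braid whose numbers
at the bottom are the same as at the top. -/
def IsAlexanderNumbering (β : VirtualBraid k) (a : Fin k → ℤ) : Prop := β.HasNumbering a a

/-- The strands of the closed braid, cut into pieces: the piece `(l, i)` arrives at the letter
number `l` at position `i`.  Going through this letter one arrives at the next one; below the last
letter the closing strands lead back to the first letter. -/
def step (β : VirtualBraid k) : Equiv.Perm (Fin β.length × Fin k) :=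
  Equiv.prodShear (finRotate β.length) fun l => (β.get l).perm

/-- The place of a passage through a classical crossing of the closed braid. -/
def place (β : VirtualBraid k) (e : {l : Fin β.length // (β.get l).IsClassical} × Bool) :
    Fin β.length × Fin k :=
  (e.1.1, (β.get e.1.1).entry e.2)

theorem place_injective (β : VirtualBraid k) : Function.Injective β.place := by
  rintro ⟨⟨l, hl⟩, b⟩ ⟨⟨l', hl'⟩, b'⟩ h
  simp only [place, Prod.mk.injEq] at h
  obtain ⟨rfl, h⟩ := h
  simp [(β.get l).entry_injective h]

end VirtualBraid

section FirstReturn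

variable {P α : Type} [Finite α] (f : Equiv.Perm α) (ι : P → α)

theorem exists_return (e : P) : ∃ n, 0 < n ∧ (f ^ n) (ι e) ∈ Set.range ι :=
  ⟨orderOf f, orderOf_pos f, e, by simp [pow_orderOf_eq_one]⟩

open Classical in
/-- The number of steps after which the orbit of `ι e` under `f` meets the image of `ι` again. -/
def returnTime (e : P) : ℕ := Nat.find (exists_return f ι e)

theorem returnTime_pos (e : P) : 0 < returnTime f ι e := by
  classical
  exact (Nat.find_spec (exists_return f ι e)).1

/-- Where the orbit of `ι e` under `f` meets the image of `ι` again for the first time. -/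
def firstReturnFun (e : P) : P := by
  classical
  exact (Nat.find_spec (exists_return f ι e)).2.choose

theorem firstReturnFun_spec (e : P) :
    ι (firstReturnFun f ι e) = (f ^ returnTime f ι e) (ι e) := by
  classical
  exact (Nat.find_spec (exists_return f ι e)).2.choose_spec

theorem returnTime_le {e e' : P} {n : ℕ} (hn : 0 < n) (h : (f ^ n) (ι e) = ι e') :
    returnTime f ι e ≤ n := by
  classical
  exact Nat.find_min' _ ⟨hn, e', h.symm⟩

theorem firstReturnFun_injective (hι : Function.Injective ι) :
    Function.Injective (firstReturnFun f ι) := by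
  have aux : ∀ e e' : P, returnTime f ι e ≤ returnTime f ι e' →
      firstReturnFun f ι e = firstReturnFun f ι e' → e = e' := by
    intro e e' hle h
    have h1 := firstReturnFun_spec f ι e
    rw [h, firstReturnFun_spec f ι e'] at h1
    obtain ⟨m, hm⟩ := Nat.exists_eq_add_of_le hle
    rw [hm, pow_add, Equiv.Perm.mul_apply, EmbeddingLike.apply_eq_iff_eq] at h1
    rcases Nat.eq_zero_or_pos m with rfl | hpos
    · exact hι (by simpa using h1.symm)
    · have := returnTime_le f ι hpos h1
      have := returnTime_pos f ι e
      omega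
  intro e e' h
  rcases le_total (returnTime f ι e) (returnTime f ι e') with hle | hle
  · exact aux e e' hle h
  · exact (aux e' e hle h.symm).symm

/-- The first return map of `f` to the image of the injection `ι`, as a permutation. -/
def firstReturn (hι : Function.Injective ι) : Equiv.Perm P :=
  haveI : Finite P := Finite.of_injective ι hι
  Equiv.ofBijective (firstReturnFun f ι)
    (Finite.injective_iff_bijective.1 (firstReturnFun_injective f ι hι))

theorem firstReturn_sameCycle (hι : Function.Injective ι) {e e' : P}
    (h : f.SameCycle (ι e) (ι e')) : (firstReturn f ι hι).SameCycle e e' := by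
  obtain ⟨n, hn⟩ := h.exists_nat_pow_eq
  clear h
  induction n using Nat.strong_induction_on generalizing e with
  | _ n ih =>
    rcases Nat.eq_zero_or_pos n with rfl | hpos
    · rw [hι (by simpa using hn : ι e = ι e')]
    · obtain ⟨m, hm⟩ := Nat.exists_eq_add_of_le (returnTime_le f ι hpos hn)
      have := returnTime_pos f ι e
      have key : (f ^ m) (ι (firstReturnFun f ι e)) = ι e' := by
        rw [firstReturnFun_spec f ι e, ← Equiv.Perm.mul_apply, ← pow_add, add_comm, ← hm, hn]
      have := ih m (by omega) key
      exact Equiv.Perm.sameCycle_apply_left.1 this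

end FirstReturn

namespace VirtualBraid

variable {k : ℕ}

theorem step_apply (β : VirtualBraid k) (l : Fin β.length) (i : Fin k) :
    β.step (l, i) = (finRotate β.length l, (β.get l).perm i) := rfl

theorem perm_take_succ (β : VirtualBraid k) (n : ℕ) (hn : n < β.length) :
    perm (β.take (n + 1)) = (β.get ⟨n, hn⟩).perm * perm (β.take n) := by
  induction β generalizing n with
  | nil => simp at hn
  | cons x β ih =>
    cases n with
    | zero => simp [perm]
    | succ n =>
      have := ih n (by simpa using hn)
      simp only [List.take_succ_cons, perm, this, mul_assoc]
      rfl

theorem step_pow (β : VirtualBraid k) (n : ℕ) (hn : n < β.length) (i : Fin k) :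
    (β.step ^ n) (⟨0, by omega⟩, i) = (⟨n, hn⟩, perm (β.take n) i) := by
  induction n with
  | zero => simp [perm]
  | succ n ih =>
    rw [pow_succ', Equiv.Perm.mul_apply, ih (by omega), step_apply, perm_take_succ β n (by omega)]
    refine Prod.ext ?_ rfl
    obtain ⟨L, hL⟩ : ∃ L, β.length = L + 1 := ⟨β.length - 1, by omega⟩
    have : ∀ (N : ℕ) (_ : N = L + 1) (h1 : n < N) (h2 : n + 1 < N),
        finRotate N ⟨n, h1⟩ = ⟨n + 1, h2⟩ := by
      rintro _ rfl h1 h2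
      exact finRotate_of_lt (by omega)
    exact this _ hL _ _

theorem step_pow_length (β : VirtualBraid k) (hβ : 0 < β.length) (i : Fin k) :
    (β.step ^ β.length) (⟨0, hβ⟩, i) = (⟨0, hβ⟩, perm β i) := by
  obtain ⟨L, hL⟩ : ∃ L, β.length = L + 1 := ⟨β.length - 1, by omega⟩
  have h1 : (β.step ^ β.length) (⟨0, hβ⟩, i) = β.step ((β.step ^ L) (⟨0, hβ⟩, i)) := by
    rw [← Equiv.Perm.mul_apply, ← pow_succ', ← hL]
  rw [h1, step_pow β L (by omega), step_apply]
  have h2 : perm β = (β.get ⟨L, by omega⟩).perm * perm (β.take L) := by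
    rw [← perm_take_succ, ← hL, List.take_length]
  rw [h2]
  refine Prod.ext ?_ rfl
  have : ∀ (N : ℕ) (_ : N = L + 1) (h1 : L < N) (h2 : 0 < N), finRotate N ⟨L, h1⟩ = ⟨0, h2⟩ := by
    rintro _ rfl h1 h2
    exact finRotate_last'
  exact this _ hL _ _

theorem step_sameCycle (β : VirtualBraid k) (h : β.ClosureIsKnot) (x y : Fin β.length × Fin k) :
    β.step.SameCycle x y := by
  have hβ : 0 < β.length := x.1.pos
  have top : ∀ i j, β.step.SameCycle (⟨0, hβ⟩, i) (⟨0, hβ⟩, j) := by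
    intro i j
    obtain ⟨n, hn⟩ := (h.2 i j).exists_nat_pow_eq
    subst hn
    induction n with
    | zero => exact Equiv.Perm.SameCycle.refl _ _
    | succ n ih =>
      refine ih.trans ⟨β.length, ?_⟩
      rw [zpow_natCast, step_pow_length, pow_succ', Equiv.Perm.mul_apply]
  have reach : ∀ x : Fin β.length × Fin k, ∃ i, β.step.SameCycle (⟨0, hβ⟩, i) x := by
    rintro ⟨⟨n, hn⟩, i⟩
    refine ⟨(perm (β.take n)).symm i, n, ?_⟩
    rw [zpow_natCast, step_pow β n hn]
    simp
  obtain ⟨i, hi⟩ := reach x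
  obtain ⟨j, hj⟩ := reach y
  exact hi.symm.trans ((top i j).trans hj)

/-- The closure of a virtual braid, as a virtual knot diagram: its crossings are the classical
letters of the braid word, and the passage following a given one is the first one that is met when
one follows the strand downwards, returning to the top whenever the bottom is reached. -/
def closure (β : VirtualBraid k) (h : β.ClosureIsKnot) : GaussDiagram where
  Crossing := {l : Fin β.length // (β.get l).IsClassical}
  finite := inferInstance
  positive := fun c => (β.get c.1).isPositive
  next := firstReturn β.step β.place β.place_injective
  connected := fun _ _ => firstReturn_sameCycle _ _ _ (β.step_sameCycle h _ _)

end VirtualBraid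

/-! ### Congruence modulo `p` up to units `± t ^ m` -/

/-- Reduction of the coefficients modulo `p`. -/
def reduceMod (p : ℕ) : LaurentPolynomial ℤ →+* LaurentPolynomial (ZMod p) :=
  AddMonoidAlgebra.mapRingHom ℤ (Int.castRingHom (ZMod p))

/-- `f` and `g` agree modulo `p` up to a factor `± t ^ m`. -/
def DotEqMod (p : ℕ) (f g : LaurentPolynomial ℤ) : Prop :=
  ∃ m : ℤ, reduceMod p f = LaurentPolynomial.T m * reduceMod p g ∨
    reduceMod p f = -(LaurentPolynomial.T m * reduceMod p g)

end

open Matrix in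
theorem Matrix.adjugate_apply_eq_of_mulVec_one_eq_zero {n R : Type*} [Fintype n] [DecidableEq n]
    [CommRing R] [IsDomain R] {A : Matrix n n R} (h : A *ᵥ 1 = 0) (a a' c : n) :
    A.adjugate a c = A.adjugate a' c := by
  have : Nonempty n := ⟨a⟩
  rw [← sub_eq_zero, adjugate_def, of_apply, of_apply, ← Pi.sub_apply, ← map_sub, cramer_transpose_apply]
  refine exists_mulVec_eq_zero_iff.1 ⟨1, one_ne_zero, ?_⟩
  ext i
  by_cases hi : i = c
  · subst hi
    simp [mulVec, dotProduct]
  · simpa [mulVec, updateRow_ne hi] using congrFun h i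

open Matrix in
/-- If the row sums of a square matrix vanish and a row vector of units is a relation between its
rows, then the adjugate matrix is a multiple of a matrix of rank one. -/
theorem Matrix.exists_adjugate_eq {n R : Type*} [Fintype n] [DecidableEq n] [Nonempty n]
    [CommRing R] [IsDomain R] {A : Matrix n n R} (h : A *ᵥ 1 = 0) (w : n → Rˣ)
    (hw : (fun i => (w i : R)) ᵥ* A = 0) : ∃ δ, ∀ i j, A.adjugate i j = δ * w j := by
  obtain ⟨c⟩ := ‹Nonempty n›
  have key : (of fun i j => (w i : R) * A i j)ᵀ *ᵥ 1 = 0 := by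
    ext j
    simpa [mulVec, vecMul, dotProduct] using congrFun hw j
  have hD : (of fun i j => (w i : R) * A i j) = diagonal (fun i => (w i : R)) * A := by
    ext i j
    simp
  have hd := fun a c c' => adjugate_apply_eq_of_mulVec_one_eq_zero key c c' a
  simp only [← adjugate_transpose, transpose_apply, hD, adjugate_mul_distrib,
    adjugate_diagonal, mul_diagonal] at hd
  let P : R := ∏ i, (w i : R)
  have hP : ∀ j, ∏ i ∈ Finset.univ.erase j, (w i : R) = P * ↑(w j)⁻¹ := by
    intro j
    rw [Units.eq_mul_inv_iff_mul_eq, Finset.prod_erase_mul _ _ (Finset.mem_univ j)]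
  have hP0 : P ≠ 0 := Finset.prod_ne_zero_iff.2 fun i _ => (w i).ne_zero
  refine ⟨A.adjugate c c * ↑(w c)⁻¹, fun i j => ?_⟩
  have h1 := hd i j c
  rw [hP, hP, ← mul_assoc, ← mul_assoc, mul_comm _ P, mul_comm _ P, mul_assoc, mul_assoc] at h1
  have h2 := mul_left_cancel₀ hP0 h1
  rw [← Units.eq_mul_inv_iff_mul_eq, inv_inv] at h2
  rw [h2, adjugate_apply_eq_of_mulVec_one_eq_zero h i c c]

open Matrix in
/-- Elimination of the indices outside the image of `ι`: if `M` is unitriangular there and the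
columns of `E` extend the unit vectors by solutions of the equations outside the image, then only
the remaining equations contribute to the determinant. -/
theorem Matrix.det_eq_det_submatrix_mul {α S R : Type*} [Fintype α] [DecidableEq α] [Fintype S]
    [DecidableEq S] [CommRing R] (M : Matrix α α R) (ι : S → α) (hι : Function.Injective ι)
    (b : α → ℕ) (h1 : ∀ y, y ∉ Set.range ι → M y y = 1)
    (h2 : ∀ y, y ∉ Set.range ι → ∀ z, z ≠ y → M y z ≠ 0 → b z < b y)
    (E : Matrix α S R) (hE : E.submatrix ι id = 1)
    (hM : ∀ y, y ∉ Set.range ι → ∀ s, (M * E) y s = 0) :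
    M.det = ((M * E).submatrix ι id).det := by
  classical
  let e : S ⊕ {y // y ∉ Set.range ι} ≃ α :=
    ((Equiv.ofInjective ι hι).sumCongr (Equiv.refl _)).trans (Equiv.sumCompl _)
  have el : ∀ s, e (Sum.inl s) = ι s := fun s => rfl
  have er : ∀ y, e (Sum.inr y) = y.1 := fun s => rfl
  let F : Matrix α (S ⊕ {y // y ∉ Set.range ι}) R :=
    of fun a => Sum.elim (E a) (fun y => if a = y.1 then 1 else 0)
  have hF : (F.submatrix e id).det = 1 := by
    have : F.submatrix e id = fromBlocks 1 0 (E.submatrix (fun y => y.1) id) 1 := by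
      ext (i | i) (j | j)
      · exact congrFun (congrFun hE i) j
      · have : ι i ≠ j.1 := fun h => j.2 ⟨i, h⟩
        simp [F, el, this]
      · rfl
      · simp [F, er, one_apply, Subtype.ext_iff]
    rw [this, det_fromBlocks_zero₁₂]
    simp
  have hMF : (M.submatrix e e) * (F.submatrix e id) =
      fromBlocks ((M * E).submatrix ι id) (M.submatrix ι (fun y => y.1)) 0
        (M.submatrix (fun y : {y // y ∉ Set.range ι} => y.1) (fun y => y.1)) := by
    rw [submatrix_mul_equiv]
    ext (i | i) (j | j)
    · simp [F, el, mul_apply]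
    · simp [F, el, mul_apply]
    · simpa [F, er, mul_apply] using hM i.1 i.2 j
    · simp [F, er, mul_apply]
  have hdet : (M.submatrix (fun y : {y // y ∉ Set.range ι} => y.1) (fun y => y.1)).det = 1 := by
    have ht : BlockTriangular (M.submatrix (fun y : {y // y ∉ Set.range ι} => y.1) (fun y => y.1))
        (fun y => OrderDual.toDual (b y.1)) := by
      intro i j hij
      by_contra h
      refine absurd (h2 i.1 i.2 j.1 ?_ h) (not_lt.2 (le_of_lt hij))
      rintro h'
      exact absurd hij (by simp [h'])
    rw [ht.det]
    refine Finset.prod_eq_one fun a _ => ?_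
    rw [← det_one (n := {y : {y // y ∉ Set.range ι} // OrderDual.toDual (b y.1) = a})]
    congr 1
    ext i j
    by_cases hij : i = j
    · subst hij
      simpa [toSquareBlock_def] using h1 _ i.1.2
    · rw [one_apply_ne hij, toSquareBlock_def, of_apply, submatrix_apply]
      by_contra h
      have := h2 i.1.1 i.1.2 j.1.1 (fun h' => hij (Subtype.ext (Subtype.ext h'.symm))) h
      have h3 := i.2.trans j.2.symm
      simp only [EmbeddingLike.apply_eq_iff_eq] at h3
      omega
  have := congrArg det hMF
  rw [det_mul, det_submatrix_equiv_self, hF, det_fromBlocks_zero₂₁, hdet, mul_one, mul_one] at this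
  exact this

open Matrix in
theorem Matrix.adjugate_one_sub_eq {α S R : Type*} [Fintype α] [DecidableEq α] [Fintype S]
    [DecidableEq S] [CommRing R] (U : Matrix α α R) (ι : S → α) (hι : Function.Injective ι)
    (b : α → ℕ) (hU : ∀ y, y ∉ Set.range ι → ∀ z, U y z ≠ 0 → b z < b y)
    (E : Matrix α S R) (hE : E.submatrix ι id = 1)
    (hM : ∀ y, y ∉ Set.range ι → ∀ s, (U * E) y s = E y s) (s t : S) :
    (1 - U).adjugate (ι s) (ι t) = (1 - (U * E).submatrix ι id).adjugate s t := by
  rw [adjugate_apply, adjugate_apply]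
  have hne : ∀ y, y ∉ Set.range ι → y ≠ ι t := fun y hy h => hy ⟨t, h.symm⟩
  have hrow : ∀ y, y ≠ ι t → ∀ s', (((1 - U).updateRow (ι t) (Pi.single (ι s) 1)) * E) y s' =
      E y s' - (U * E) y s' := by
    intro y hy s'
    have : (1 - U) * E = E - U * E := by rw [Matrix.sub_mul, Matrix.one_mul]
    rw [mul_apply]
    simp only [updateRow_ne hy]
    rw [← mul_apply, this, Matrix.sub_apply]
  rw [det_eq_det_submatrix_mul _ ι hι b _ _ E hE]
  · congr 1
    ext i j
    by_cases hi : i = t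
    · subst hi
      rw [submatrix_apply, mul_apply, updateRow_self]
      simp only [updateRow_self]
      simpa [Pi.single_apply, one_apply, eq_comm] using congrFun (congrFun hE s) j
    · rw [submatrix_apply, hrow _ (fun h => hi (hι h)), updateRow_ne hi, Matrix.sub_apply]
      exact congrArg (· - _) (congrFun (congrFun hE i) j)
  · intro y hy s'
    rw [hrow y (hne y hy), hM y hy, sub_self]
  · intro y hy
    rw [updateRow_ne (hne y hy), Matrix.sub_apply, one_apply_eq]
    have : U y y = 0 := by
      by_contra h
      exact lt_irrefl _ (hU y hy y h)
    rw [this, sub_zero]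
  · intro y hy z hz h
    rw [updateRow_ne (hne y hy), Matrix.sub_apply, one_apply_ne hz.symm, zero_sub] at h
    exact hU y hy z (neg_ne_zero.1 h)

theorem elementaryIdeal_submatrix_equiv {R m n m' n' : Type} [CommRing R] (l : ℕ)
    (A : Matrix m n R) (e : m' ≃ m) (e' : n' ≃ n) :
    elementaryIdeal l (A.submatrix e e') = elementaryIdeal l A := by
  unfold elementaryIdeal
  rw [Nat.card_congr e']
  congr 1
  ext d
  constructor
  · rintro ⟨f, g, rfl⟩
    exact ⟨e ∘ f, e' ∘ g, rfl⟩
  · rintro ⟨f, g, rfl⟩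
    refine ⟨e.symm ∘ f, e'.symm ∘ g, ?_⟩
    congr 1
    ext
    simp

open Matrix in
theorem elementaryIdeal_one_le_span_iff {R n : Type} [CommRing R] [Fintype n] [DecidableEq n]
    [Nonempty n] (A : Matrix n n R) (d : R) :
    elementaryIdeal 1 A ≤ Ideal.span {d} ↔ ∀ i j, d ∣ A.adjugate i j := by
  obtain ⟨m, hm⟩ : ∃ m, Fintype.card n = m + 1 :=
    ⟨Fintype.card n - 1, by have := Fintype.card_pos (α := n); omega⟩
  let e : Fin (m + 1) ≃ n := (Fintype.equivFinOfCardEq hm).symm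
  have red : (∀ i j, d ∣ A.adjugate i j) ↔ ∀ i j, d ∣ (A.submatrix e e).adjugate i j := by
    simp only [adjugate_submatrix_equiv_self, submatrix_apply]
    exact ⟨fun h i j => h _ _, fun h i j => by simpa using h (e.symm i) (e.symm j)⟩
  rw [← elementaryIdeal_submatrix_equiv 1 A e e, red]
  generalize A.submatrix e e = A'
  rw [elementaryIdeal, Ideal.span_le]
  have hc : Nat.card (Fin (m + 1)) - 1 = m := by simp
  rw [hc]
  constructor
  · intro h i j
    rw [adjugate_fin_succ_eq_det_submatrix]
    exact Dvd.dvd.mul_left (Ideal.mem_span_singleton.1 (h ⟨_, _, rfl⟩)) _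
  · rintro h _ ⟨f, g, rfl⟩
    apply Ideal.mem_span_singleton.2
    let f' : Fin (m + 1) → Fin (m + 1) := Fin.cons 0 f
    let g' : Fin (m + 1) → Fin (m + 1) := Fin.cons 0 g
    have hs : A'.submatrix f' g' =
        (1 : Matrix _ _ R).submatrix f' id * A' * (1 : Matrix _ _ R).submatrix id g' := by
      ext i j
      simp [mul_apply, one_apply]
    have h0 : (A'.submatrix f g).det = (A'.submatrix f' g').adjugate 0 0 := by
      rw [adjugate_fin_succ_eq_det_submatrix]
      simp only [Fin.val_zero, add_zero, pow_zero, one_mul]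
      rfl
    rw [h0, hs, adjugate_mul_distrib, adjugate_mul_distrib, mul_apply]
    refine Finset.dvd_sum fun i _ => Dvd.dvd.mul_left ?_ _
    rw [mul_apply]
    exact Finset.dvd_sum fun i _ => Dvd.dvd.mul_right (h _ _) _

open Polynomial LaurentPolynomial in
theorem LaurentPolynomial.exists_eq_T_or_neg_T_of_isUnit {u : ℤ[T;T⁻¹]} (hu : IsUnit u) :
    ∃ m : ℤ, u = T m ∨ u = -T m := by
  obtain ⟨v, huv⟩ := hu.exists_right_inv
  obtain ⟨n, P, hP⟩ := exists_T_pow u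
  obtain ⟨m, Q, hQ⟩ := exists_T_pow v
  have hPQ : P * Q = X ^ (n + m) := by
    apply toLaurent_injective
    rw [map_mul, hP, hQ, toLaurent_X_pow, mul_mul_mul_comm, huv, one_mul, ← T_add]
    simp
  obtain ⟨i, _, hi⟩ := (dvd_prime_pow (prime_X (R := ℤ)) _).1 (Dvd.intro _ hPQ)
  obtain ⟨w, hw⟩ := hi.symm
  have hu : u = Polynomial.toLaurent P * T (-n) := by
    rw [hP, mul_assoc, ← T_add, add_neg_cancel, T_zero, mul_one]
  obtain ⟨r, hr, hr'⟩ := Polynomial.isUnit_iff.1 w.isUnit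
  rw [hu, ← hw, map_mul, toLaurent_X_pow, ← hr', toLaurent_C]
  refine ⟨i + -n, ?_⟩
  rcases Int.isUnit_iff.1 hr with rfl | rfl
  · left
    rw [map_one, mul_one, ← T_add]
  · right
    rw [map_neg, map_one, mul_neg, mul_one, neg_mul, ← T_add]

open Matrix in
theorem Matrix.vecMulVec_one_pow {n R : Type*} [Fintype n] [DecidableEq n] [CommRing R] (w : n → R)
    (q : ℕ) : vecMulVec (1 : n → R) w ^ (q + 1) = (∑ i, w i) ^ q • vecMulVec 1 w := by
  induction q with
  | zero => simp
  | succ q ih =>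
    rw [pow_succ, ih, smul_mul_assoc, vecMulVec_mul_vecMulVec]
    ext i j
    simp [dotProduct, pow_succ, mul_assoc]

open Matrix in
theorem Matrix.adjugate_one_sub_pow_char {n R : Type*} [Fintype n] [DecidableEq n] [CommRing R]
    {p : ℕ} [Fact p.Prime] [CharP R p] (r : ℕ) (B : Matrix n n R) (δ : R) (w : n → R)
    (h : ∀ i j, (1 - B).adjugate i j = δ * w j) (i j : n) :
    (1 - B ^ p ^ r).adjugate i j = δ ^ p ^ r * (∑ i, w i) ^ (p ^ r - 1) * w j := by
  have : Nonempty n := ⟨i⟩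
  have h1 : (1 - B).adjugate = δ • vecMulVec (1 : n → R) w := by
    ext i j
    simp [h]
  have h2 : 1 - B ^ p ^ r = (1 - B) ^ p ^ r := by
    rw [sub_pow_char_pow_of_commute (p := p) _ (Commute.one_left B), one_pow]
  obtain ⟨q, hq⟩ : ∃ q, p ^ r = q + 1 :=
    ⟨p ^ r - 1, by have := pow_pos (Fact.out : p.Prime).pos r; omega⟩
  rw [h2, adjugate_pow, h1, smul_pow, hq, vecMulVec_one_pow]
  simp [mul_assoc]

open Matrix in
theorem Matrix.dvd_adjugate_one_sub_pow {n R : Type*} [Fintype n] [DecidableEq n] [CommRing R]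
    {B : Matrix n n R} {δ : R} (h : ∀ i j, δ ∣ (1 - B).adjugate i j) (q : ℕ) (i j : n) :
    δ ∣ (1 - B ^ q).adjugate i j := by
  rw [← mul_neg_geom_sum, adjugate_mul_distrib, mul_apply]
  exact Finset.dvd_sum fun l _ => Dvd.dvd.mul_left (h l j) _

namespace BraidLetter

variable {k : ℕ}

theorem perm_entry (x : BraidLetter k) (b : Bool) : x.perm (x.entry b) = x.entry (!b) := by
  unfold perm entry
  generalize x.isPositive = s
  cases s <;> cases b <;> simp

theorem perm_perm (x : BraidLetter k) (i : Fin k) : x.perm (x.perm i) = i := by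
  simp [perm]

/-- The coefficient of the over-strand in the relation at a crossing. -/
noncomputable def overCoeff (x : BraidLetter k) : LaurentPolynomial ℤ :=
  match x.kind with
  | CrossingKind.positive => 1 - LaurentPolynomial.T (-1)
  | CrossingKind.negative => 1 - LaurentPolynomial.T 1
  | CrossingKind.virtual => 0

theorem isClassical_of_overCoeff_ne_zero (x : BraidLetter k) (h : x.overCoeff ≠ 0) :
    x.IsClassical := by
  intro h'
  simp [overCoeff, h'] at h

theorem overCoeff_of_isClassical (x : BraidLetter k) (h : x.IsClassical) :
    x.overCoeff = 1 - LaurentPolynomial.T (if x.isPositive then -1 else 1) := by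
  unfold overCoeff isPositive
  unfold IsClassical at h
  cases hx : x.kind <;> simp_all

/-- The Burau matrix of a letter: it expresses the strands below the letter by those above. -/
noncomputable def burau (x : BraidLetter k) : Matrix (Fin k) (Fin k) (LaurentPolynomial ℤ) :=
  Matrix.of fun j i => (if x.perm i = j then 1 else 0) +
    if j = x.entry true then
      x.overCoeff * ((if i = x.entry true then 1 else 0) - if i = x.entry false then 1 else 0)
    else 0

theorem sum_burau_mul (x : BraidLetter k) (j : Fin k) (g : Fin k → LaurentPolynomial ℤ) :
    ∑ i, x.burau j i * g i = g (x.perm j) +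
      if j = x.entry true then x.overCoeff * (g (x.entry true) - g (x.entry false)) else 0 := by
  have h : ∀ i, x.perm i = j ↔ i = x.perm j := fun i =>
    ⟨fun h => by rw [← h, perm_perm], fun h => by rw [h, perm_perm]⟩
  simp only [burau, Matrix.of_apply, add_mul, Finset.sum_add_distrib, h]
  congr 1
  · simp
  · split_ifs
    · simp [mul_assoc, ← Finset.mul_sum, sub_mul]
    · simp

theorem sum_mul_burau (x : BraidLetter k) (i : Fin k) (w : Fin k → LaurentPolynomial ℤ) :
    ∑ j, w j * x.burau j i = w (x.perm i) + w (x.entry true) * (x.overCoeff *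
      ((if i = x.entry true then 1 else 0) - if i = x.entry false then 1 else 0)) := by
  simp [burau, mul_add, Finset.sum_add_distrib]

/-- The rule which relates the numbers above and below a letter in an Alexander numbering. -/
def NumberingRule (x : BraidLetter k) (a b : Fin k → ℤ) : Prop :=
  match x.kind with
  | CrossingKind.virtual => b = a ∘ x.perm
  | _ => a x.right = a x.left + 1 ∧ b = a

theorem NumberingRule.sum_T_mul_burau {x : BraidLetter k} {a b : Fin k → ℤ}
    (h : x.NumberingRule a b) (i : Fin k) :
    ∑ j, LaurentPolynomial.T (b j) * x.burau j i = LaurentPolynomial.T (a i) := by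
  rw [sum_mul_burau]
  have hlr := x.left_ne_right
  have swap : ∀ i, x.perm i = if i = x.left then x.right else if i = x.right then x.left else i :=
    fun i => Equiv.swap_apply_def _ _ _
  unfold NumberingRule at h
  unfold overCoeff entry isPositive
  cases hx : x.kind with
  | virtual =>
    simp only [hx] at h
    simp [h, perm_perm]
  | positive =>
    simp only [hx] at h
    obtain ⟨h1, rfl⟩ := h
    rw [swap]
    have e : (LaurentPolynomial.T (b x.left) : LaurentPolynomial ℤ) =
        LaurentPolynomial.T (b x.right) * LaurentPolynomial.T (-1) := by
      rw [← LaurentPolynomial.T_add, h1]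
      simp
    by_cases hl : i = x.left
    · subst hl
      simp only [hlr, ↓reduceIte, reduceCtorEq, e]
      ring
    · by_cases hr : i = x.right
      · subst hr
        simp only [hlr.symm, ↓reduceIte, reduceCtorEq, e]
        ring
      · simp [hl, hr]
  | negative =>
    simp only [hx] at h
    obtain ⟨h1, rfl⟩ := h
    rw [swap]
    have e : (LaurentPolynomial.T (b x.right) : LaurentPolynomial ℤ) =
        LaurentPolynomial.T (b x.left) * LaurentPolynomial.T 1 := by
      rw [← LaurentPolynomial.T_add, h1]
    by_cases hl : i = x.left
    · subst hl
      simp only [hlr, ↓reduceIte, reduceCtorEq, e]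
      ring
    · by_cases hr : i = x.right
      · subst hr
        simp only [hlr.symm, ↓reduceIte, reduceCtorEq, e]
        ring
      · simp [hl, hr]

end BraidLetter

theorem finRotate_val {n : ℕ} (l : Fin n) : (finRotate n l : ℕ) = (l + 1) % n := by
  cases n with
  | zero => exact l.elim0
  | succ n =>
    rw [finRotate_apply, Fin.val_add]
    simp

theorem exists_backward_arc {α C : Type} [Finite α] [Nonempty C] (f : Equiv.Perm α)
    (hf : ∀ x y, f.SameCycle x y) (u : C → α) (hu : Function.Injective u) :
    ∃ (a : α → C) (b : α → ℕ), (∀ c, a (f (u c)) = c) ∧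
      ∀ y, y ∉ Set.range u → a (f y) = a y ∧ b y < b (f y) := by
  classical
  have ex : ∀ y, ∃ n, (f.symm ^ (n + 1)) y ∈ Set.range u := by
    intro y
    obtain ⟨c⟩ := ‹Nonempty C›
    obtain ⟨n, hn⟩ := (hf (f.symm y) (u c)).inv.exists_nat_pow_eq
    exact ⟨n, c, by rw [← hn, pow_succ]; rfl⟩
  choose a ha using fun y => Nat.find_spec (ex y)
  refine ⟨a, fun y => Nat.find (ex y), fun c => ?_, fun y hy => ?_⟩
  · have h0 : Nat.find (ex (f (u c))) = 0 := (Nat.find_eq_zero _).2 ⟨c, by simp⟩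
    apply hu
    rw [ha, h0]
    simp
  · have hs : ∀ n, (f.symm ^ (n + 1 + 1)) (f y) = (f.symm ^ (n + 1)) y := by
      intro n
      rw [pow_succ _ (n + 1), Equiv.Perm.mul_apply, Equiv.symm_apply_apply]
    have h1 : Nat.find (ex (f y)) = Nat.find (ex y) + 1 := by
      rw [Nat.find_comp_succ (ex (f y)) (by simpa only [hs] using ex y) (by simpa using hy)]
      simp only [hs]
    refine ⟨hu ?_, (Nat.lt_succ_self (Nat.find (ex y))).trans_eq h1.symm⟩
    rw [ha, ha, h1, hs]

namespace VirtualBraid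

variable {k : ℕ}

theorem HasNumbering.exists_levels {β : VirtualBraid k} {a b : Fin k → ℤ}
    (h : β.HasNumbering a b) : ∃ ν : ℕ → Fin k → ℤ, ν 0 = a ∧ ν β.length = b ∧
      ∀ l : Fin β.length, (β.get l).NumberingRule (ν l) (ν (l + 1)) := by
  induction β generalizing a with
  | nil => exact ⟨fun _ => a, rfl, h, fun l => l.elim0⟩
  | cons x β ih =>
    have : ∃ c, x.NumberingRule a c ∧ HasNumbering β c b := by
      unfold HasNumbering at h
      unfold BraidLetter.NumberingRule
      cases hx : x.kind <;> simp only [hx] at h ⊢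
      · exact ⟨a, ⟨h.1, rfl⟩, h.2⟩
      · exact ⟨a, ⟨h.1, rfl⟩, h.2⟩
      · exact ⟨_, rfl, h⟩
    obtain ⟨c, hc, hβ⟩ := this
    obtain ⟨ν, h0, h1, h2⟩ := ih hβ
    refine ⟨fun n => Nat.casesOn n a ν, rfl, h1, fun l => ?_⟩
    induction l using Fin.cases with
    | zero => simpa [h0] using hc
    | succ l => exact h2 l

/-- The Burau matrix of a braid. -/
noncomputable def burau : VirtualBraid k → Matrix (Fin k) (Fin k) (LaurentPolynomial ℤ)
  | [] => 1
  | x :: β => burau β * x.burau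

theorem burau_append (β γ : VirtualBraid k) :
    burau (β ++ γ : VirtualBraid k) = burau γ * burau β := by
  induction β with
  | nil => simp [burau]
  | cons x β ih => rw [List.cons_append, burau, burau, ih, mul_assoc]

theorem burau_power (β : VirtualBraid k) (q : ℕ) : (β.power q).burau = β.burau ^ q := by
  induction q with
  | zero => simp [power, burau]
  | succ q ih =>
    rw [pow_succ, ← ih, power, List.replicate_succ, List.flatten_cons]
    exact burau_append _ _

theorem burau_take_succ (β : VirtualBraid k) (l : Fin β.length) :
    burau (β.take (l + 1)) = (β.get l).burau * burau (β.take l) := by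
  induction β with
  | nil => exact l.elim0
  | cons x β ih =>
    induction l using Fin.cases with
    | zero => simp [burau]
    | succ l =>
      simp only [Fin.val_succ, List.take_succ_cons, burau, ih l, mul_assoc]
      rfl

/-- The matrix which expresses every piece of the strands of the closed braid by the pieces one
level above. -/
noncomputable def levelMatrix (β : VirtualBraid k) :
    Matrix (Fin β.length × Fin k) (Fin β.length × Fin k) (LaurentPolynomial ℤ) :=
  Matrix.of fun y z =>
    if finRotate β.length z.1 = y.1 then (β.get z.1).burau y.2 z.2 else 0

theorem sum_levelMatrix_mul (β : VirtualBraid k) (l : Fin β.length) (j : Fin k)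
    (g : Fin β.length × Fin k → LaurentPolynomial ℤ) :
    ∑ z, β.levelMatrix (finRotate _ l, j) z * g z = ∑ i, (β.get l).burau j i * g (l, i) := by
  rw [Fintype.sum_prod_type, Finset.sum_eq_single l]
  · simp [levelMatrix]
  · intro l' _ hl
    simp [levelMatrix, hl]
  · simp

theorem sum_mul_levelMatrix (β : VirtualBraid k) (l : Fin β.length) (i : Fin k)
    (g : Fin β.length × Fin k → LaurentPolynomial ℤ) :
    ∑ y, g y * β.levelMatrix y (l, i) =
      ∑ j, g (finRotate _ l, j) * (β.get l).burau j i := by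
  rw [Fintype.sum_prod_type, Finset.sum_eq_single (finRotate _ l)]
  · simp [levelMatrix]
  · intro l' _ hl
    refine Finset.sum_eq_zero fun j _ => ?_
    simp only [levelMatrix, Matrix.of_apply, if_neg hl.symm, mul_zero]
  · simp

theorem levelMatrix_mul_step {S : Type} (β : VirtualBraid k)
    (E : Matrix (Fin β.length × Fin k) S (LaurentPolynomial ℤ)) (z : Fin β.length × Fin k)
    (s : S) : (β.levelMatrix * E) (β.step z) s = E z s +
      if z.2 = (β.get z.1).entry false then (β.get z.1).overCoeff *
        (E (z.1, (β.get z.1).entry true) s - E (z.1, (β.get z.1).entry false) s) else 0 := by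
  obtain ⟨l, i⟩ := z
  rw [Matrix.mul_apply, step_apply, sum_levelMatrix_mul, BraidLetter.sum_burau_mul,
    BraidLetter.perm_perm]
  congr 1
  refine if_congr ⟨fun h => ?_, fun h => ?_⟩ rfl rfl
  · rw [← BraidLetter.perm_perm _ i, h, BraidLetter.perm_entry]
    rfl
  · simp only at h
    rw [h, BraidLetter.perm_entry]
    rfl

theorem levelMatrix_mul_step_of_not {S : Type} (β : VirtualBraid k)
    (E : Matrix (Fin β.length × Fin k) S (LaurentPolynomial ℤ)) {z : Fin β.length × Fin k}
    (hz : ¬ ((β.get z.1).IsClassical ∧ z.2 = (β.get z.1).entry false)) (s : S) :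
    (β.levelMatrix * E) (β.step z) s = E z s := by
  rw [levelMatrix_mul_step]
  split_ifs with h'
  · by_cases hc : (β.get z.1).overCoeff = 0
    · rw [hc, zero_mul, add_zero]
    · exact absurd ⟨(β.get z.1).isClassical_of_overCoeff_ne_zero hc, h'⟩ hz
  · exact add_zero _

theorem eq_of_levelMatrix_step_ne_zero (β : VirtualBraid k) {z z' : Fin β.length × Fin k}
    (hz : ¬ ((β.get z.1).IsClassical ∧ z.2 = (β.get z.1).entry false))
    (h : β.levelMatrix (β.step z) z' ≠ 0) : z' = z := by
  by_contra hne
  rw [← Matrix.mul_one β.levelMatrix, levelMatrix_mul_step_of_not _ _ hz] at h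
  exact h (Matrix.one_apply_ne (Ne.symm hne))

theorem exists_adjugate_levelMatrix (β : VirtualBraid k) (hk : 0 < k) (hβ : 0 < β.length)
    {lam : Fin k → ℤ} (hlam : β.IsAlexanderNumbering lam) :
    ∃ (δ : LaurentPolynomial ℤ) (ν : Fin β.length × Fin k → ℤ),
      (∀ y z, (1 - β.levelMatrix).adjugate y z = δ * LaurentPolynomial.T (ν z)) ∧
      ∀ i, ν (⟨0, hβ⟩, i) = lam i := by
  obtain ⟨ν, h0, h1, h2⟩ := HasNumbering.exists_levels hlam
  have : Nonempty (Fin β.length × Fin k) := ⟨(⟨0, hβ⟩, ⟨0, hk⟩)⟩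
  let w : Fin β.length × Fin k → (LaurentPolynomial ℤ)ˣ :=
    fun z => (LaurentPolynomial.isUnit_T (ν z.1 z.2)).unit
  obtain ⟨δ, hδ⟩ := Matrix.exists_adjugate_eq (A := 1 - β.levelMatrix) (w := w) (by
      funext y
      obtain ⟨z, rfl⟩ := β.step.surjective y
      have := β.levelMatrix_mul_step (Matrix.of fun _ (_ : Unit) => 1) z ()
      rw [Matrix.sub_mulVec, Matrix.one_mulVec]
      rw [Matrix.mul_apply] at this
      simpa [Matrix.mulVec, dotProduct, sub_eq_zero] using this.symm) (by
      funext ⟨l, i⟩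
      have hnext : ∀ j, ν (finRotate _ l) j = ν (l + 1) j := by
        intro j
        rw [finRotate_val]
        rcases Nat.lt_or_ge (l + 1) β.length with h | h
        · rw [Nat.mod_eq_of_lt h]
        · have : (l : ℕ) + 1 = β.length := le_antisymm l.2 h
          rw [this, Nat.mod_self, h0, h1]
      rw [Matrix.vecMul_sub, Matrix.vecMul_one, Pi.sub_apply, Matrix.vecMul, dotProduct,
        sum_mul_levelMatrix]
      simp only [w, IsUnit.unit_spec, hnext, (h2 l).sum_T_mul_burau]
      simp)
  exact ⟨δ, fun z => ν z.1 z.2, hδ, fun i => congrFun h0 i⟩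

theorem adjugate_one_sub_burau (β : VirtualBraid k) (hβ : 0 < β.length) (i j : Fin k) :
    (1 - β.burau).adjugate i j =
      (1 - β.levelMatrix).adjugate (⟨0, hβ⟩, i) (⟨0, hβ⟩, j) := by
  let ι : Fin k → Fin β.length × Fin k := fun i => (⟨0, hβ⟩, i)
  let E : Matrix (Fin β.length × Fin k) (Fin k) (LaurentPolynomial ℤ) :=
    Matrix.of fun y i => burau (β.take y.1) y.2 i
  have hE : ∀ l j s, (β.levelMatrix * E) (finRotate _ l, j) s = burau (β.take (l + 1)) j s := by
    intro l j s
    rw [Matrix.mul_apply, sum_levelMatrix_mul, burau_take_succ, Matrix.mul_apply]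
    rfl
  have hι : ∀ y, y ∉ Set.range ι → (y.1 : ℕ) ≠ 0 := by
    rintro ⟨l, j⟩ hy h
    exact hy ⟨j, Prod.ext (Fin.ext h.symm) rfl⟩
  have hrot : ∀ l : Fin β.length, (finRotate _ l : ℕ) ≠ 0 → (finRotate _ l : ℕ) = l + 1 := by
    intro l hl
    rw [finRotate_val] at hl ⊢
    rcases Nat.lt_or_ge (l + 1) β.length with h | h
    · rw [Nat.mod_eq_of_lt h]
    · rw [le_antisymm l.2 h, Nat.mod_self] at hl
      exact absurd rfl hl
  have hV : (β.levelMatrix * E).submatrix ι id = β.burau := by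
    ext1 i s
    have hlast : finRotate β.length ⟨β.length - 1, by omega⟩ = ⟨0, hβ⟩ := by
      apply Fin.ext
      rw [finRotate_val]
      simp only [Nat.sub_add_cancel hβ, Nat.mod_self]
    have := hE ⟨β.length - 1, by omega⟩ i s
    rw [hlast] at this
    simpa [Nat.sub_add_cancel hβ] using this
  rw [← hV]
  refine (Matrix.adjugate_one_sub_eq β.levelMatrix ι (fun _ _ h => (Prod.ext_iff.1 h).2)
    (fun y => y.1) ?_ E ?_ ?_ i j).symm
  · rintro y hy z h
    have h' : finRotate β.length z.1 = y.1 := by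
      by_contra hne
      exact h (by rw [levelMatrix, Matrix.of_apply, if_neg hne])
    have := hrot z.1 (by rw [h']; exact hι y hy)
    rw [h'] at this
    omega
  · ext i j
    simp [ι, E, burau]
  · rintro ⟨l, j⟩ hy s
    obtain ⟨l, rfl⟩ := (finRotate _).surjective l
    rw [hE, ← hrot l (hι _ hy)]
    rfl

end VirtualBraid

namespace GaussDiagram

open Classical in
/-- The entries of the Jacobian matrix, in terms of the indicator function of the long arc. -/
theorem jacobian_apply (D : GaussDiagram) (c : D.Crossing) (x : D.LongArc)
    (χ : D.LongArc → LaurentPolynomial ℤ) (hχ : ∀ y, χ y = if y = x then 1 else 0) :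
    D.jacobian c x =
      (1 - LaurentPolynomial.T (if D.positive c then -1 else 1)) *
        (χ (D.longArc (c, true)) - χ (D.longArc (D.next.symm (c, false)))) +
      χ (D.longArc (D.next.symm (c, false))) - χ (D.longArc (c, false)) := by
  have h1 : (LaurentPolynomial.T 1 * LaurentPolynomial.T (-1) : LaurentPolynomial ℤ) = 1 := by
    rw [← LaurentPolynomial.T_add]
    simp
  unfold jacobian relator
  simp only [hχ]
  generalize D.longArc (c, true) = a
  generalize D.longArc (D.next.symm (c, false)) = b
  generalize D.longArc (c, false) = d
  cases D.positive c
  all_goals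
    simp only [foxDerivative, Bool.not_true, Bool.not_false, if_true, Bool.false_eq_true, if_false]
    split_ifs <;> grind

theorem Iso.longArc_eq_iff {D D' : GaussDiagram} (φ : D.Iso D') (e f : D.Crossing × Bool) :
    D'.longArc (φ.toEquiv e.1, e.2) = D'.longArc (φ.toEquiv f.1, f.2) ↔
      D.longArc e = D.longArc f := by
  have hn : ∀ e : D'.Crossing × Bool, D.next (φ.toEquiv.symm e.1, e.2) =
      (φ.toEquiv.symm (D'.next e).1, (D'.next e).2) := by
    intro e
    have := φ.next_apply (φ.toEquiv.symm e.1, e.2)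
    simp only [Equiv.apply_symm_apply] at this
    rw [show (e.1, e.2) = e from rfl] at this
    rw [this]
    simp
  constructor
  · let F : D'.LongArc → D.LongArc := Quot.lift (fun e => D.longArc (φ.toEquiv.symm e.1, e.2)) (by
      rintro e f ⟨rfl, h⟩
      exact Quot.sound ⟨(hn e).symm, h⟩)
    intro h
    simpa [F, longArc] using congrArg F h
  · let F : D.LongArc → D'.LongArc := Quot.lift (fun e => D'.longArc (φ.toEquiv e.1, e.2)) (by
      rintro e f ⟨rfl, h⟩
      exact Quot.sound ⟨(φ.next_apply e).symm, h⟩)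
    intro h
    simpa [F, longArc] using congrArg F h

theorem Iso.elementaryIdeal_eq {D D' : GaussDiagram} (φ : D.Iso D') (l : ℕ) :
    elementaryIdeal l D.jacobian = elementaryIdeal l D'.jacobian := by
  let F : D.LongArc → D'.LongArc := Quot.lift (fun e => D'.longArc (φ.toEquiv e.1, e.2)) (by
      rintro e f ⟨rfl, h⟩
      exact Quot.sound ⟨(φ.next_apply e).symm, h⟩)
  have hF : Function.Bijective F := by
    constructor
    · rintro ⟨e⟩ ⟨f⟩ h
      exact (φ.longArc_eq_iff e f).1 h
    · rintro ⟨e⟩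
      exact ⟨D.longArc (φ.toEquiv.symm e.1, e.2),
        congrArg D'.longArc (Prod.ext (φ.toEquiv.apply_symm_apply _) rfl)⟩
  rw [← elementaryIdeal_submatrix_equiv l D'.jacobian φ.toEquiv (Equiv.ofBijective F hF)]
  congr 1
  ext1 c x
  obtain ⟨e, rfl⟩ : ∃ e, D.longArc e = x := Quot.exists_rep x
  have hs : D'.next.symm (φ.toEquiv c, false) =
      (φ.toEquiv (D.next.symm (c, false)).1, (D.next.symm (c, false)).2) := by
    rw [Equiv.symm_apply_eq, φ.next_apply]
    simp
  classical
  let χ : D.LongArc → LaurentPolynomial ℤ := fun y => if y = D.longArc e then 1 else 0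
  let χ' : D'.LongArc → LaurentPolynomial ℤ :=
    fun y => if y = D'.longArc (φ.toEquiv e.1, e.2) then 1 else 0
  have hχ : ∀ f, χ' (D'.longArc (φ.toEquiv f.1, f.2)) = χ (D.longArc f) :=
    fun f => if_congr (φ.longArc_eq_iff f e) rfl rfl
  rw [Matrix.submatrix_apply, D.jacobian_apply c _ χ (fun _ => rfl),
    D'.jacobian_apply _ (Equiv.ofBijective F hF (D.longArc e)) χ' (fun _ => rfl), φ.positive_apply, hs, hχ, hχ (c, true), hχ (c, false)]

/-- Every long arc starts at exactly one under-passage. -/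
theorem exists_longArc_eq (D : GaussDiagram) (e : D.Crossing × Bool) :
    ∃ c, D.longArc e = D.longArc (c, false) := by
  have := D.finite
  obtain ⟨n, hn⟩ := (D.connected (e.1, false) e).exists_nat_pow_eq
  rw [← hn]
  clear hn
  induction n with
  | zero => exact ⟨e.1, rfl⟩
  | succ n ih =>
    rw [pow_succ', Equiv.Perm.mul_apply]
    rcases h : D.next ((D.next ^ n) (e.1, false)) with ⟨c, b⟩
    cases b with
    | false => exact ⟨c, rfl⟩
    | true =>
      obtain ⟨c', hc'⟩ := ih
      refine ⟨c', hc' ▸ (Quot.sound ⟨h.symm, rfl⟩ : D.longArc _ = D.longArc _).symm⟩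

end GaussDiagram

namespace VirtualBraid

variable {k : ℕ}

/-- The place of a passage of the closure of a braid. -/
def closurePlace (β : VirtualBraid k) (h : β.ClosureIsKnot) :
    (β.closure h).Crossing × Bool → Fin β.length × Fin k := β.place

theorem closurePlace_injective (β : VirtualBraid k) (h : β.ClosureIsKnot) :
    Function.Injective (β.closurePlace h) := β.place_injective

theorem apply_step_closurePlace_eq {C : Type} (β : VirtualBraid k) (h : β.ClosureIsKnot)
    (a : Fin β.length × Fin k → C)
    (ha : ∀ y, y ∉ Set.range (fun c => β.closurePlace h (c, false)) → a (β.step y) = a y)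
    (e : (β.closure h).Crossing × Bool) :
    a (β.step (β.closurePlace h e)) = a (β.closurePlace h ((β.closure h).next e)) := by
  have hret : β.closurePlace h ((β.closure h).next e) =
      (β.step ^ returnTime β.step (β.closurePlace h) e) (β.closurePlace h e) := firstReturnFun_spec _ _ _
  have key : ∀ m, 0 < m → m ≤ returnTime β.step (β.closurePlace h) e →
      a ((β.step ^ m) (β.closurePlace h e)) = a (β.step (β.closurePlace h e)) := by
    intro m hm
    induction m, hm using Nat.le_induction with
    | base => simp
    | succ m hm ih =>
      intro hle
      rw [← ih (by omega), pow_succ', Equiv.Perm.mul_apply, ha]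
      rintro ⟨c, hc⟩
      have := returnTime_le β.step (β.closurePlace h) hm hc.symm
      omega
  rw [hret, key _ (returnTime_pos _ _ _) le_rfl]

theorem elementaryIdeal_closure_le_iff (β : VirtualBraid k) (h : β.ClosureIsKnot)
    [Nonempty (β.closure h).Crossing] :
    ∃ ι : (β.closure h).Crossing → Fin β.length × Fin k, ∀ d : LaurentPolynomial ℤ,
      elementaryIdeal 1 (β.closure h).jacobian ≤ Ideal.span {d} ↔
        ∀ c c', d ∣ (1 - β.levelMatrix).adjugate (ι c) (ι c') := by
  classical
  have := (β.closure h).finite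
  let _ := Fintype.ofFinite (β.closure h).Crossing
  let u : (β.closure h).Crossing → Fin β.length × Fin k := fun c => β.closurePlace h (c, false)
  have hu : Function.Injective u := fun c c' hc => (Prod.ext_iff.1 (β.closurePlace_injective h hc)).1
  obtain ⟨a, b, hau, hab⟩ := exists_backward_arc β.step (β.step_sameCycle h) u hu
  have hnext := β.apply_step_closurePlace_eq h a fun y hy => (hab y hy).1
  have htrue : ∀ c, a (β.step (β.closurePlace h (c, true))) = a (β.closurePlace h (c, true)) := by
    intro c
    refine (hab _ ?_).1
    rintro ⟨c', hc'⟩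
    simpa using (Prod.ext_iff.1 (β.closurePlace_injective h hc')).2
  let A : (β.closure h).LongArc → (β.closure h).Crossing :=
    Quot.lift (fun e => a (β.step (β.closurePlace h e))) (by
      rintro e ⟨c, b⟩ ⟨hc, rfl⟩
      rw [hnext, ← hc, htrue])
  have hA : ∀ e c, (β.closure h).longArc e = (β.closure h).longArc (c, false) ↔
      a (β.step (β.closurePlace h e)) = c := by
    intro e c
    constructor
    · intro hc
      exact (congrArg A hc).trans (hau c)
    · rintro rfl
      obtain ⟨c, hc⟩ := (β.closure h).exists_longArc_eq e
      rw [hc]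
      congr 2
      exact ((congrArg A hc).trans (hau c)).symm
  let Φ : (β.closure h).Crossing ≃ (β.closure h).LongArc :=
    Equiv.ofBijective (fun c => (β.closure h).longArc (c, false)) ⟨fun c c' hc =>
        (hau c).symm.trans ((hA _ _).1 hc), by
      rintro ⟨e⟩
      obtain ⟨c, hc⟩ := (β.closure h).exists_longArc_eq e
      exact ⟨c, hc.symm⟩⟩
  let ι : (β.closure h).Crossing → Fin β.length × Fin k := fun c => β.step (u c)
  let E : Matrix (Fin β.length × Fin k) (β.closure h).Crossing (LaurentPolynomial ℤ) :=
    Matrix.of fun y c => if a y = c then 1 else 0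
  have hnot : ∀ z, z ∉ Set.range u →
      ¬ ((β.get z.1).IsClassical ∧ z.2 = (β.get z.1).entry false) := by
    rintro ⟨l, i⟩ hz ⟨h1, h2⟩
    exact hz ⟨⟨l, h1⟩, Prod.ext rfl h2.symm⟩
  have hι : ∀ z, β.step z ∉ Set.range ι → z ∉ Set.range u := by
    rintro z hz ⟨c, rfl⟩
    exact hz ⟨c, rfl⟩
  have hJ : (β.closure h).jacobian.submatrix (Equiv.refl _) Φ =
      (-1 : LaurentPolynomial ℤ) • (1 - (β.levelMatrix * E).submatrix ι id) := by
    ext1 c c'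
    let χ : (β.closure h).LongArc → LaurentPolynomial ℤ :=
      fun y => if y = (β.closure h).longArc (c', false) then 1 else 0
    have hχ : ∀ e, χ ((β.closure h).longArc e) = E (β.step (β.closurePlace h e)) c' :=
      fun e => if_congr (hA e c') rfl rfl
    have htrue' : E (β.step (β.closurePlace h (c, true))) = E (β.closurePlace h (c, true)) := by
      funext c'
      simp only [E, Matrix.of_apply, htrue]
    have hnext' : ∀ e, E (β.step (β.closurePlace h e)) =
        E (β.closurePlace h ((β.closure h).next e)) := by
      intro e
      funext c'
      simp only [E, Matrix.of_apply, hnext]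
    have hone : E (β.step (β.closurePlace h (c, false))) c' =
        (1 : Matrix _ _ (LaurentPolynomial ℤ)) c c' :=
      if_congr (by rw [show a (β.step (β.closurePlace h (c, false))) = c from hau c]) rfl rfl
    rw [Matrix.submatrix_apply, GaussDiagram.jacobian_apply _ _ (Φ c') χ (fun _ => rfl), Equiv.refl_apply, hχ, hχ, hχ,
      htrue', hnext', Equiv.apply_symm_apply, hone, Matrix.smul_apply, Matrix.sub_apply,
      Matrix.submatrix_apply, levelMatrix_mul_step,
      if_pos (show (u c).2 = (β.get (u c).1).entry false from rfl),
      (β.get (u c).1).overCoeff_of_isClassical c.2]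
    change _ = (-1 : LaurentPolynomial ℤ) * (_ - (E (β.closurePlace h (c, false)) c' +
      (1 - LaurentPolynomial.T (if (β.closure h).positive c then -1 else 1)) *
      (E (β.closurePlace h (c, true)) c' - E (β.closurePlace h (c, false)) c')))
    ring
  refine ⟨ι, fun d => ?_⟩
  rw [← elementaryIdeal_submatrix_equiv 1 _ (Equiv.refl _) Φ, hJ, elementaryIdeal_one_le_span_iff,
    Matrix.adjugate_smul]
  have hunit : IsUnit ((-1 : LaurentPolynomial ℤ) ^ (Fintype.card (β.closure h).Crossing - 1)) :=
    isUnit_one.neg.pow _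
  simp only [Matrix.smul_apply, smul_eq_mul, hunit.dvd_mul_left]
  refine forall₂_congr fun c c' => ?_
  rw [Matrix.adjugate_one_sub_eq β.levelMatrix ι (fun _ _ hc => hu (β.step.injective hc)) b ?_ E
    ?_ ?_]
  · intro y hy z hz
    obtain ⟨y, rfl⟩ := β.step.surjective y
    rw [β.eq_of_levelMatrix_step_ne_zero (hnot y (hι y hy)) hz]
    exact (hab y (hι y hy)).2
  · ext1 c c'
    simp [E, ι, hau, Matrix.one_apply]
  · intro y hy c
    obtain ⟨y, rfl⟩ := β.step.surjective y
    rw [levelMatrix_mul_step_of_not _ _ (hnot y (hι y hy))]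
    simp only [E, Matrix.of_apply, (hab y (hι y hy)).1]

end VirtualBraid

namespace VirtualBraid

variable {k : ℕ}

theorem exists_adjugate_levelMatrix_eq_one (β : VirtualBraid k) (h : β.ClosureIsKnot)
    [IsEmpty (β.closure h).Crossing] (hβ : 0 < β.length) :
    ∃ y, (1 - β.levelMatrix).adjugate y y = 1 := by
  classical
  let u : Unit → Fin β.length × Fin k := fun _ => (⟨0, hβ⟩, ⟨0, h.1⟩)
  obtain ⟨a, b, -, hab⟩ := exists_backward_arc β.step (β.step_sameCycle h) u
    (fun _ _ _ => rfl)
  have hnot : ∀ z : Fin β.length × Fin k,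
      ¬ ((β.get z.1).IsClassical ∧ z.2 = (β.get z.1).entry false) :=
    fun z hz => IsEmpty.false (α := (β.closure h).Crossing) ⟨z.1, hz.1⟩
  let ι : Unit → Fin β.length × Fin k := fun c => β.step (u c)
  let E : Matrix (Fin β.length × Fin k) Unit (LaurentPolynomial ℤ) := Matrix.of fun _ _ => 1
  have hU : ∀ z s, (β.levelMatrix * E) (β.step z) s = 1 := fun z s =>
    levelMatrix_mul_step_of_not _ _ (hnot z) s
  refine ⟨ι (), ?_⟩
  rw [Matrix.adjugate_one_sub_eq β.levelMatrix ι (fun _ _ _ => rfl) b ?_ E ?_ ?_ () (),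
    Matrix.adjugate_subsingleton, Matrix.one_apply_eq]
  · intro y hy z hz
    obtain ⟨y, rfl⟩ := β.step.surjective y
    rw [β.eq_of_levelMatrix_step_ne_zero (hnot y) hz]
    refine (hab y ?_).2
    rintro ⟨c, rfl⟩
    exact hy ⟨c, rfl⟩
  · ext1
    simp [E]
  · intro y _ s
    obtain ⟨y, rfl⟩ := β.step.surjective y
    exact hU y s

/-- The Alexander polynomial of the closure of a braid with an Alexander numbering is determined
by the adjugate matrix of `1 - B`, where `B` is the Burau matrix of the braid. -/
theorem exists_alexander_generator (β : VirtualBraid k) (h : β.ClosureIsKnot) {lam : Fin k → ℤ}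
    (hlam : β.IsAlexanderNumbering lam) :
    ∃ δ : LaurentPolynomial ℤ,
      (∀ i j, (1 - β.burau).adjugate i j = δ * LaurentPolynomial.T (lam j)) ∧
      ∀ d, elementaryIdeal 1 (β.closure h).jacobian ≤ Ideal.span {d} ↔ d ∣ δ := by
  have hempty : IsEmpty (β.closure h).Crossing → ∀ (δ d : LaurentPolynomial ℤ), IsUnit δ →
      (elementaryIdeal 1 (β.closure h).jacobian ≤ Ideal.span {d} ↔ d ∣ δ) := by
    intro hC δ d hδ
    have : IsEmpty (β.closure h).LongArc := ⟨by
      rintro ⟨e⟩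
      exact hC.false e.1⟩
    have htop : elementaryIdeal 1 (β.closure h).jacobian = ⊤ := by
      refine (Ideal.eq_top_iff_one _).2 (Ideal.subset_span ?_)
      have h0 : Nat.card (β.closure h).LongArc - 1 = 0 := by simp
      rw [h0]
      exact ⟨Fin.elim0, Fin.elim0, by simp⟩
    rw [htop, top_le_iff, Ideal.span_singleton_eq_top]
    exact ⟨fun hd => hd.dvd, fun hd => isUnit_of_dvd_unit hd hδ⟩
  rcases Nat.eq_zero_or_pos β.length with h0 | hβ
  · obtain rfl := List.length_eq_zero_iff.1 h0
    have hs : Subsingleton (Fin k) := ⟨fun i j => by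
      obtain ⟨n, hn⟩ := h.2 i j
      simpa [perm] using hn⟩
    refine ⟨LaurentPolynomial.T (-lam ⟨0, h.1⟩), fun i j => ?_, fun d =>
      hempty ⟨fun c => c.1.elim0⟩ _ d (LaurentPolynomial.isUnit_T _)⟩
    rw [Matrix.adjugate_subsingleton, ← LaurentPolynomial.T_add, Subsingleton.elim i j,
      Subsingleton.elim j ⟨0, h.1⟩, neg_add_cancel, LaurentPolynomial.T_zero, Matrix.one_apply_eq]
  · obtain ⟨δ, ν, hδ, hν⟩ := β.exists_adjugate_levelMatrix h.1 hβ hlam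
    refine ⟨δ, fun i j => ?_, fun d => ?_⟩
    · rw [adjugate_one_sub_burau β hβ, hδ, hν]
    · rcases isEmpty_or_nonempty (β.closure h).Crossing with hC | ⟨⟨c⟩⟩
      · obtain ⟨y, hy⟩ := β.exists_adjugate_levelMatrix_eq_one h hβ
        rw [hδ] at hy
        exact hempty hC _ _ (IsUnit.of_mul_eq_one _ hy)
      · have : Nonempty (β.closure h).Crossing := ⟨c⟩
        obtain ⟨ι, hι⟩ := β.elementaryIdeal_closure_le_iff h
        rw [hι]
        simp only [hδ, (LaurentPolynomial.isUnit_T _).dvd_mul_right]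
        exact ⟨fun H => H c c, fun H _ _ => H⟩

end VirtualBraid

theorem firstReturn_semiconj {P P' α α' : Type} [Finite α] [Finite α'] (f : Equiv.Perm α)
    (f' : Equiv.Perm α') {ι : P → α} {ι' : P' → α'} (hι : Function.Injective ι)
    (hι' : Function.Injective ι') (π : α → α') (g : P → P') (hπ : ∀ x, π (f x) = f' (π x))
    (hg : ∀ e, π (ι e) = ι' (g e)) (hr : ∀ x, π x ∈ Set.range ι' → x ∈ Set.range ι) (e : P) :
    firstReturn f' ι' hι' (g e) = g (firstReturn f ι hι e) := by
  have hpow : ∀ n x, π ((f ^ n) x) = (f' ^ n) (π x) := by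
    intro n
    induction n with
    | zero => simp
    | succ n ih => intro x; rw [pow_succ, pow_succ, Equiv.Perm.mul_apply, ih, hπ]; rfl
  have h1 : (f' ^ returnTime f ι e) (ι' (g e)) = ι' (g (firstReturnFun f ι e)) := by
    rw [← hg, ← hg, ← hpow, firstReturnFun_spec f ι]
  have hle : returnTime f ι e ≤ returnTime f' ι' (g e) := by
    obtain ⟨e', he'⟩ := hr ((f ^ returnTime f' ι' (g e)) (ι e))
      ⟨firstReturnFun f' ι' (g e), by rw [hpow, hg, firstReturnFun_spec f' ι']⟩
    exact returnTime_le f ι (returnTime_pos _ _ _) he'.symm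
  have heq := le_antisymm (returnTime_le f' ι' (returnTime_pos _ _ _) h1) hle
  apply hι'
  change ι' (firstReturnFun f' ι' (g e)) = _
  rw [firstReturnFun_spec f' ι', heq, h1]
  rfl

theorem finRotate_pow_val {n : ℕ} (m : ℕ) (l : Fin n) :
    ((finRotate n ^ m) l : ℕ) = (l + m) % n := by
  induction m with
  | zero => simp [Nat.mod_eq_of_lt l.2]
  | succ m ih =>
    rw [pow_succ', Equiv.Perm.mul_apply, finRotate_val, ih, Nat.mod_add_mod, add_assoc]

namespace GaussDiagram

theorem apply_rotation_eq {D D' : GaussDiagram} {q : ℕ} (hq : 0 < q) {ρ : Equiv.Perm D.Crossing}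
    (hρ : D.IsRotation q ρ) (π : D.Crossing → D'.Crossing)
    (hnext : ∀ e : D.Crossing × Bool, D'.next (π e.1, e.2) = (π (D.next e).1, (D.next e).2))
    (hcard : Nat.card D.Crossing = q * Nat.card D'.Crossing) (c : D.Crossing) :
    π (ρ c) = π c := by
  classical
  have := D.finite
  have := D'.finite
  let _ := Fintype.ofFinite D.Crossing
  let _ := Fintype.ofFinite D'.Crossing
  have cyc : ∀ D : GaussDiagram, ∀ _ : Fintype D.Crossing,
      D.next.IsCycleOn ((Finset.univ : Finset (D.Crossing × Bool)) : Set (D.Crossing × Bool)) :=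
    fun D _ => ⟨by simp, fun x _ y _ => D.connected x y⟩
  obtain ⟨m, hm⟩ := (D.connected (c, true) (ρ c, true)).exists_nat_pow_eq
  have hcomm : ∀ n (e : D.Crossing × Bool),
      (D.next ^ n) (ρ e.1, e.2) = (ρ ((D.next ^ n) e).1, ((D.next ^ n) e).2) := by
    intro n
    induction n with
    | zero => intro e; rfl
    | succ n ih =>
      intro e
      rw [pow_succ, Equiv.Perm.mul_apply, Equiv.Perm.mul_apply, hρ.next_apply, ih]
  have hproj : ∀ n (e : D.Crossing × Bool),
      (D'.next ^ n) (π e.1, e.2) = (π ((D.next ^ n) e).1, ((D.next ^ n) e).2) := by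
    intro n
    induction n with
    | zero => intro e; rfl
    | succ n ih =>
      intro e
      rw [pow_succ, pow_succ, Equiv.Perm.mul_apply, Equiv.Perm.mul_apply, hnext, ih]
  have hpow : ∀ j, (D.next ^ (m * j)) (c, true) = ((ρ ^ j) c, true) := by
    intro j
    induction j with
    | zero => simp
    | succ j ih =>
      have := hcomm (m * j) (c, true)
      simp only [ih] at this
      rw [mul_add, mul_one, pow_add, Equiv.Perm.mul_apply, hm, this, pow_succ']
      rfl
  have hfix := hpow q
  rw [hρ.pow_eq_one, Equiv.Perm.one_apply, (cyc D _).pow_apply_eq (Finset.mem_univ _),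
    Finset.card_univ, ← Nat.card_eq_fintype_card, Nat.card_prod, hcard, mul_comm m, mul_assoc,
    ← Nat.card_prod] at hfix
  have hdvd := Nat.dvd_of_mul_dvd_mul_left hq hfix
  rw [Nat.card_eq_fintype_card, ← Finset.card_univ,
    ← (cyc D' _).pow_apply_eq (Finset.mem_univ (π c, true))] at hdvd
  have := hproj m (c, true)
  simp only [hdvd, hm] at this
  exact (Prod.ext_iff.1 this).1.symm

theorem card_quotient_mul_le {D : GaussDiagram} {q : ℕ} {ρ : Equiv.Perm D.Crossing}
    (hρ : D.IsRotation q ρ) : Nat.card (D.quotient hρ).Crossing * q ≤ Nat.card D.Crossing := by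
  have := D.finite
  let F : (D.quotient hρ).Crossing × Fin q → D.Crossing :=
    fun x => (ρ ^ (x.2 : ℕ)) (Quotient.out x.1)
  have hF : Function.Injective F := by
    rintro ⟨x, i⟩ ⟨y, j⟩ hxy
    have hxy' : (ρ ^ (i : ℕ)) (Quotient.out x) = (ρ ^ (j : ℕ)) (Quotient.out y) := hxy
    have hsame : ρ.SameCycle (Quotient.out x) (Quotient.out y) := by
      rw [← Equiv.Perm.sameCycle_pow_left (n := i), hxy']
      exact (Equiv.Perm.SameCycle.refl _ _).pow_left
    have : x = y := Quotient.out_equiv_out.1 hsame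
    subst this
    have aux : ∀ a b : Fin q, a < b →
        (ρ ^ (a : ℕ)) (Quotient.out x) ≠ (ρ ^ (b : ℕ)) (Quotient.out x) := by
      intro a b hab h
      obtain ⟨d, hd⟩ := Nat.exists_eq_add_of_lt (show (a : ℕ) < b from hab)
      rw [hd, add_assoc, pow_add, Equiv.Perm.mul_apply, EmbeddingLike.apply_eq_iff_eq] at h
      exact hρ.free (d + 1) (Nat.succ_pos d) (by omega) _ h.symm
    rcases lt_trichotomy i j with hij | rfl | hij
    · exact absurd hxy' (aux _ _ hij)
    · rfl
    · exact absurd hxy'.symm (aux _ _ hij)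
  have := Nat.card_le_card_of_injective F hF
  rwa [Nat.card_prod, Nat.card_fin] at this

/-- A covering of Gauss diagrams of degree `q` identifies its target with the quotient by every
rotation of order `q`. -/
theorem nonempty_quotient_iso {D D' : GaussDiagram} {q : ℕ} (hq : 0 < q)
    {ρ : Equiv.Perm D.Crossing} (hρ : D.IsRotation q ρ) (π : D.Crossing → D'.Crossing)
    (hpos : ∀ c, D'.positive (π c) = D.positive c)
    (hnext : ∀ e : D.Crossing × Bool, D'.next (π e.1, e.2) = (π (D.next e).1, (D.next e).2))
    (hsurj : Function.Surjective π)
    (hcard : Nat.card D.Crossing = q * Nat.card D'.Crossing) :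
    Nonempty ((D.quotient hρ).Iso D') := by
  have := D'.finite
  have := (D.quotient hρ).finite
  have hπ := apply_rotation_eq hq hρ π hnext hcard
  have hπz : ∀ (m : ℤ) c, π ((ρ ^ m) c) = π c := by
    intro m
    induction m with
    | zero => simp
    | succ n ih => intro c; rw [zpow_add, zpow_one, Equiv.Perm.mul_apply, ih, hπ]
    | pred n ih =>
      intro c
      rw [sub_eq_add_neg, zpow_add, zpow_neg_one, Equiv.Perm.mul_apply, ih, ← hπ]
      simp
  let F : (D.quotient hρ).Crossing → D'.Crossing := Quotient.lift π (by
    rintro c d ⟨m, rfl⟩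
    exact (hπz m c).symm)
  have hF : Function.Surjective F := by
    intro c'
    obtain ⟨c, rfl⟩ := hsurj c'
    exact ⟨Quotient.mk _ c, rfl⟩
  have hle : Nat.card (D.quotient hρ).Crossing ≤ Nat.card D'.Crossing := by
    have := card_quotient_mul_le hρ
    rw [hcard, mul_comm] at this
    exact Nat.le_of_mul_le_mul_left this hq
  refine ⟨Equiv.ofBijective F (hF.bijective_of_nat_card_le hle), fun c => ?_, ?_⟩
  · induction c using Quotient.inductionOn with
    | h c => exact hpos c
  · rintro ⟨c, b⟩
    induction c using Quotient.inductionOn with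
    | h c => exact hnext (c, b)

end GaussDiagram

namespace VirtualBraid

variable {k : ℕ}

/-- The map of crossings of closures induced by a map of levels which preserves the letters. -/
def crossingMap {β γ : VirtualBraid k} (hβ : β.ClosureIsKnot) (hγ : γ.ClosureIsKnot)
    (φ : Fin β.length → Fin γ.length) (hφ : ∀ l, γ.get (φ l) = β.get l)
    (c : (β.closure hβ).Crossing) : (γ.closure hγ).Crossing :=
  ⟨φ c.1, by rw [hφ]; exact c.2⟩

theorem positive_crossingMap {β γ : VirtualBraid k} (hβ : β.ClosureIsKnot) (hγ : γ.ClosureIsKnot)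
    (φ : Fin β.length → Fin γ.length) (hφ : ∀ l, γ.get (φ l) = β.get l)
    (c : (β.closure hβ).Crossing) :
    (γ.closure hγ).positive (crossingMap hβ hγ φ hφ c) = (β.closure hβ).positive c :=
  congrArg BraidLetter.isPositive (hφ c.1)

theorem next_crossingMap {β γ : VirtualBraid k} (hβ : β.ClosureIsKnot) (hγ : γ.ClosureIsKnot)
    (φ : Fin β.length → Fin γ.length) (hφ : ∀ l, γ.get (φ l) = β.get l)
    (hrot : ∀ l, φ (finRotate _ l) = finRotate _ (φ l)) (e : (β.closure hβ).Crossing × Bool) :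
    (γ.closure hγ).next (crossingMap hβ hγ φ hφ e.1, e.2) =
      (crossingMap hβ hγ φ hφ ((β.closure hβ).next e).1, ((β.closure hβ).next e).2) := by
  refine firstReturn_semiconj β.step γ.step β.place_injective γ.place_injective
    (fun z => (φ z.1, z.2)) (fun e => (crossingMap hβ hγ φ hφ e.1, e.2)) ?_ ?_ ?_ e
  · rintro ⟨l, i⟩
    simp only [step_apply, hrot, hφ]
  · rintro ⟨c, b⟩
    exact Prod.ext rfl (congrArg (fun x : BraidLetter k => x.entry b) (hφ c.1).symm)
  · rintro ⟨l, i⟩ ⟨⟨c, b⟩, hc⟩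
    have h1 : c.1 = φ l := (Prod.ext_iff.1 hc).1
    have h2 : (γ.get c.1).entry b = i := (Prod.ext_iff.1 hc).2
    have hl : (β.get l).IsClassical := by
      rw [← hφ, ← h1]
      exact c.2
    refine ⟨(⟨l, hl⟩, b), Prod.ext rfl ?_⟩
    change (β.get l).entry b = i
    rw [← hφ, ← h1, h2]

theorem power_succ (β : VirtualBraid k) (q : ℕ) :
    β.power (q + 1) = (β ++ β.power q : VirtualBraid k) := by
  rw [power, List.replicate_succ, List.flatten_cons]
  rfl

theorem length_power (β : VirtualBraid k) (q : ℕ) : (β.power q).length = q * β.length := by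
  simp [power]

theorem perm_append (β γ : VirtualBraid k) :
    perm (β ++ γ : VirtualBraid k) = perm γ * perm β := by
  induction β with
  | nil => simp [perm]
  | cons x β ih => rw [List.cons_append, perm, perm, ih, mul_assoc]

theorem perm_power (β : VirtualBraid k) (q : ℕ) : perm (β.power q) = perm β ^ q := by
  induction q with
  | zero => rfl
  | succ q ih => rw [power_succ, perm_append, ih, pow_succ]

theorem closureIsKnot_of_power {β : VirtualBraid k} {q : ℕ} (h : (β.power q).ClosureIsKnot) :
    β.ClosureIsKnot := by
  refine ⟨h.1, fun i j => ?_⟩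
  have := h.2 i j
  rw [perm_power] at this
  exact this.of_pow

theorem HasNumbering.append {β γ : VirtualBraid k} {a b c : Fin k → ℤ} (h : HasNumbering β a b)
    (h' : HasNumbering γ b c) : HasNumbering (β ++ γ : VirtualBraid k) a c := by
  induction β generalizing a with
  | nil => exact (show a = b from h) ▸ h'
  | cons x β ih =>
    rw [List.cons_append]
    unfold HasNumbering at h ⊢
    cases hx : x.kind <;> simp only [hx] at h ⊢
    · exact ⟨h.1, ih h.2⟩
    · exact ⟨h.1, ih h.2⟩
    · exact ih h

theorem IsAlexanderNumbering.power {β : VirtualBraid k} {lam : Fin k → ℤ}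
    (h : β.IsAlexanderNumbering lam) (q : ℕ) : (β.power q).IsAlexanderNumbering lam := by
  induction q with
  | zero => exact (rfl : lam = lam)
  | succ q ih =>
    rw [power_succ]
    exact HasNumbering.append h ih

theorem getElem?_power (β : VirtualBraid k) (q i : ℕ) (h : i < q * β.length) :
    (β.power q)[i]? = β[i % β.length]? := by
  induction q generalizing i with
  | zero => simp at h
  | succ q ih =>
    rw [power_succ, List.getElem?_append]
    split_ifs with hi
    · rw [Nat.mod_eq_of_lt hi]
    · rw [ih _ (by rw [add_mul] at h; omega), ← Nat.mod_eq_sub_mod (by omega)]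

theorem get_power (β : VirtualBraid k) (q : ℕ) (l : Fin (β.power q).length)
    (l' : Fin β.length) (h : (l : ℕ) % β.length = l') : (β.power q).get l = β.get l' := by
  have := β.getElem?_power q l (by rw [← length_power]; exact l.2)
  rw [h] at this
  simpa using this

/-- The level of a braid which corresponds to a level of one of its powers. -/
def level (β : VirtualBraid k) (q : ℕ) (l : Fin (β.power q).length) : Fin β.length :=
  ⟨l % β.length, Nat.mod_lt _ (Nat.pos_of_mul_pos_left
    ((Nat.zero_le _).trans_lt (l.2.trans_eq (length_power β q))))⟩

theorem get_level (β : VirtualBraid k) (q : ℕ) (l : Fin (β.power q).length) :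
    β.get (β.level q l) = (β.power q).get l := (get_power β q l _ rfl).symm

theorem level_finRotate (β : VirtualBraid k) (q : ℕ) (l : Fin (β.power q).length) :
    β.level q (finRotate _ l) = finRotate _ (β.level q l) := by
  apply Fin.ext
  rw [finRotate_val]
  simp only [level, finRotate_val, length_power, Nat.mod_mul_left_mod, Nat.mod_add_mod]

theorem get_finRotate_pow (β : VirtualBraid k) (q : ℕ) (l : Fin (β.power q).length) :
    (β.power q).get ((finRotate _ ^ β.length) l) = (β.power q).get l := by
  rw [← get_level, ← get_level]
  congr 1
  apply Fin.ext
  simp only [level, finRotate_pow_val, length_power, Nat.mod_mul_left_mod, Nat.add_mod_right]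

/-- The rotation of the closure of a power of a braid. -/
def rotation (β : VirtualBraid k) (q : ℕ) (h : (β.power q).ClosureIsKnot) :
    Equiv.Perm ((β.power q).closure h).Crossing :=
  (finRotate (β.power q).length ^ β.length).subtypePerm fun l => by
    rw [get_finRotate_pow]

theorem rotation_pow_val (β : VirtualBraid k) (q : ℕ) (h : (β.power q).ClosureIsKnot) (j : ℕ)
    (c : ((β.power q).closure h).Crossing) :
    (((β.rotation q h ^ j) c).1 : ℕ) = (c.1 + j * β.length) % (q * β.length) := by
  have : ((β.rotation q h ^ j) c).1 = (finRotate (β.power q).length ^ (β.length * j)) c.1 := by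
    induction j generalizing c with
    | zero => simp
    | succ j ih =>
      rw [pow_succ, Equiv.Perm.mul_apply, ih, mul_add, mul_one, pow_add]
      rfl
  rw [this, finRotate_pow_val, mul_comm j]
  exact congrArg _ (length_power β q)

theorem isRotation_rotation (β : VirtualBraid k) (q : ℕ) (h : (β.power q).ClosureIsKnot) :
    ((β.power q).closure h).IsRotation q (β.rotation q h) where
  positive_apply := positive_crossingMap h h _ (β.get_finRotate_pow q)
  next_apply := next_crossingMap h h _ (β.get_finRotate_pow q) fun l => by
    rw [← Equiv.Perm.mul_apply, ← Equiv.Perm.mul_apply, ← pow_succ, ← pow_succ']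
  pow_eq_one := by
    ext1 c
    refine Subtype.ext (Fin.ext ?_)
    rw [rotation_pow_val, Nat.add_mod_right, ← length_power]
    exact Nat.mod_eq_of_lt c.1.2
  free j hj hjq c hc := by
    have h1 := β.rotation_pow_val q h j c
    have h2 : (c.1 : ℕ) < q * β.length := by
      rw [← length_power]
      exact c.1.2
    have hβ : 0 < β.length := Nat.pos_of_mul_pos_left (Nat.zero_lt_of_lt h2)
    rw [hc] at h1
    have h3 : j * β.length < q * β.length := Nat.mul_lt_mul_of_pos_right hjq hβ
    have h4 : 0 < j * β.length := Nat.mul_pos hj hβ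
    rcases Nat.lt_or_ge (c.1 + j * β.length) (q * β.length) with h5 | h5
    · rw [Nat.mod_eq_of_lt h5] at h1
      omega
    · rw [Nat.mod_eq_sub_mod h5, Nat.mod_eq_of_lt (by omega)] at h1
      omega

theorem card_crossing_power (β : VirtualBraid k) (q : ℕ) (h : (β.power q).ClosureIsKnot)
    (hβ : β.ClosureIsKnot) :
    Nat.card ((β.power q).closure h).Crossing = q * Nat.card (β.closure hβ).Crossing := by
  have hlt : ∀ (a : Fin q) (l : Fin β.length), l + β.length * a < (β.power q).length := by
    intro a l
    rw [length_power, mul_comm q]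
    calc (l : ℕ) + β.length * a < β.length + β.length * a := by have := l.2; omega
      _ = β.length * (a + 1) := by ring
      _ ≤ β.length * q := Nat.mul_le_mul_left _ a.2
  have hmod : ∀ (a : Fin q) (l : Fin β.length), (l + β.length * a) % β.length = l := by
    intro a l
    rw [Nat.add_mul_mod_self_left, Nat.mod_eq_of_lt l.2]
  let F : Fin q × (β.closure hβ).Crossing → ((β.power q).closure h).Crossing :=
    fun x => ⟨⟨x.2.1 + β.length * x.1, hlt _ _⟩, by
      rw [get_power β q _ x.2.1 (hmod _ _)]
      exact x.2.2⟩
  have hF : Function.Bijective F := by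
    constructor
    · rintro ⟨a, c⟩ ⟨a', c'⟩ he
      have he' : (c.1 : ℕ) + β.length * a = c'.1 + β.length * a' :=
        Fin.val_eq_of_eq (Subtype.ext_iff.1 he)
      have h1 := hmod a c.1
      rw [he', hmod] at h1
      rw [h1, Nat.add_left_cancel_iff, Nat.mul_right_inj (Nat.ne_of_gt c.1.pos)] at he'
      exact Prod.ext (Fin.ext he') (Subtype.ext (Fin.ext h1.symm))
    · intro c
      refine ⟨(⟨c.1 / β.length, ?_⟩, ⟨β.level q c.1, by rw [get_level]; exact c.2⟩),
        Subtype.ext (Fin.ext (Nat.mod_add_div _ _))⟩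
      apply Nat.div_lt_of_lt_mul
      rw [mul_comm, ← length_power]
      exact c.1.2
  rw [← Nat.card_congr (Equiv.ofBijective F hF), Nat.card_prod, Nat.card_fin]

theorem nonempty_quotient_iso (β : VirtualBraid k) {q : ℕ} (hq : 0 < q)
    (h : (β.power q).ClosureIsKnot) (hβ : β.ClosureIsKnot)
    {ρ : Equiv.Perm ((β.power q).closure h).Crossing}
    (hρ : ((β.power q).closure h).IsRotation q ρ) :
    Nonempty ((((β.power q).closure h).quotient hρ).Iso (β.closure hβ)) := by
  refine GaussDiagram.nonempty_quotient_iso hq hρ (crossingMap h hβ (β.level q) (β.get_level q))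
    (positive_crossingMap _ _ _ _) (next_crossingMap _ _ _ _ (β.level_finRotate q)) ?_
    (β.card_crossing_power q h hβ)
  intro c
  have hlt : (c.1 : ℕ) < (β.power q).length := by
    rw [length_power]
    exact c.1.2.trans_le (Nat.le_mul_of_pos_left _ hq)
  have hmod : (c.1 : ℕ) % β.length = c.1 := Nat.mod_eq_of_lt c.1.2
  exact ⟨⟨⟨c.1, hlt⟩, by rw [get_power β q _ c.1 hmod]; exact c.2⟩, Subtype.ext (Fin.ext hmod)⟩

end VirtualBraid

theorem reduceMod_T (p : ℕ) (n : ℤ) :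
    reduceMod p (LaurentPolynomial.T n) = LaurentPolynomial.T n := by
  simp [reduceMod, LaurentPolynomial.T, -LaurentPolynomial.single_eq_C_mul_T]

theorem dotEqMod_of_isUnit (p : ℕ) {u f g : LaurentPolynomial ℤ} (hu : IsUnit u)
    (h : reduceMod p f = reduceMod p (u * g)) : DotEqMod p f g := by
  obtain ⟨m, rfl | rfl⟩ := LaurentPolynomial.exists_eq_T_or_neg_T_of_isUnit hu
  · exact ⟨m, Or.inl (by rw [h, map_mul, reduceMod_T])⟩
  · exact ⟨m, Or.inr (by rw [h, map_mul, map_neg, reduceMod_T, neg_mul])⟩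

theorem GaussDiagram.IsAlexanderPolynomial.associated {D : GaussDiagram}
    {Δ δ : LaurentPolynomial ℤ} (h : D.IsAlexanderPolynomial Δ)
    (hδ : ∀ d, elementaryIdeal 1 D.jacobian ≤ Ideal.span {d} ↔ d ∣ δ) : Associated Δ δ :=
  associated_of_dvd_dvd ((hδ Δ).1 h.1)
    (Ideal.span_singleton_le_span_singleton.1 (h.2 δ ((hδ δ).2 dvd_rfl)))

theorem theorem1p3 (p r : ℕ) (hp : p.Prime) (hr : 0 < r) (k : ℕ) (β : VirtualBraid k)
    (lam : Fin k → ℤ) (hlam : β.IsAlexanderNumbering lam)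
    (hK : (β.power (p ^ r)).ClosureIsKnot) :
    ((β.power (p ^ r)).closure hK).IsPeriodic (p ^ r) ∧
      ∀ (ρ : Equiv.Perm ((β.power (p ^ r)).closure hK).Crossing)
        (hρ : ((β.power (p ^ r)).closure hK).IsRotation (p ^ r) ρ),
        (∃ hβ : β.ClosureIsKnot,
          Nonempty ((((β.power (p ^ r)).closure hK).quotient hρ).Iso (β.closure hβ))) ∧
        ∀ ΔK ΔQ : LaurentPolynomial ℤ,
          ((β.power (p ^ r)).closure hK).IsAlexanderPolynomial ΔK →
          (((β.power (p ^ r)).closure hK).quotient hρ).IsAlexanderPolynomial ΔQ →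
          ΔQ ∣ ΔK ∧
          DotEqMod p ΔK
            (ΔQ ^ (p ^ r) * (∑ i, LaurentPolynomial.T (lam i)) ^ (p ^ r - 1)) := by
  have hq : 0 < p ^ r := pow_pos hp.pos r
  have hβ := VirtualBraid.closureIsKnot_of_power hK
  refine ⟨⟨_, β.isRotation_rotation _ hK⟩, fun ρ hρ => ?_⟩
  obtain ⟨φ⟩ := β.nonempty_quotient_iso hq hK hβ hρ
  refine ⟨⟨hβ, ⟨φ⟩⟩, fun ΔK ΔQ hΔK hΔQ => ?_⟩
  obtain ⟨δK, hδK, hK'⟩ := (β.power (p ^ r)).exists_alexander_generator hK (hlam.power _)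
  obtain ⟨δ, hδ, hQ'⟩ := β.exists_alexander_generator hβ hlam
  have hKa := hΔK.associated hK'
  have hQa : Associated ΔQ δ := hΔQ.associated (by rw [φ.elementaryIdeal_eq]; exact hQ')
  rw [VirtualBraid.burau_power] at hδK
  let i : Fin k := ⟨0, hK.1⟩
  constructor
  · rw [hKa.dvd_iff_dvd_right, hQa.dvd_iff_dvd_left]
    rw [← (LaurentPolynomial.isUnit_T (lam i)).dvd_mul_right, ← hδK i i]
    exact Matrix.dvd_adjugate_one_sub_pow (fun i j => hδ i j ▸ dvd_mul_right _ _) _ i i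
  · have : Fact p.Prime := ⟨hp⟩
    have : CharP (LaurentPolynomial (ZMod p)) p :=
      charP_of_injective_ringHom (LaurentPolynomial.C (R := ZMod p)).injective p
    have hmod := Matrix.adjugate_one_sub_pow_char (p := p) r ((reduceMod p).mapMatrix β.burau)
      (reduceMod p δ) (fun j => LaurentPolynomial.T (lam j)) (by
        intro i j
        rw [← map_one (reduceMod p).mapMatrix, ← map_sub, ← RingHom.map_adjugate,
          RingHom.mapMatrix_apply, Matrix.map_apply, hδ, map_mul, reduceMod_T]) i i
    rw [← map_pow, ← map_one (reduceMod p).mapMatrix, ← map_sub, ← RingHom.map_adjugate,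
      RingHom.mapMatrix_apply, Matrix.map_apply, hδK, map_mul, reduceMod_T,
      (LaurentPolynomial.isUnit_T (lam i)).mul_left_inj] at hmod
    obtain ⟨u, hu⟩ := hKa.symm
    obtain ⟨v, hv⟩ := hQa
    refine dotEqMod_of_isUnit p (u * v ^ p ^ r : (LaurentPolynomial ℤ)ˣ).isUnit ?_
    rw [← hu, map_mul, hmod, ← hv]
    simp only [map_mul, map_pow, map_sum, reduceMod_T, Units.val_mul, Units.val_pow_eq_pow_val]
    ring
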